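/- **Setting.** Let $(X_i,D_i,(Y_i(d))_{d\le Q})$, $i=1,2,\dots$, be i.i.d. on a (standard Borel) probability space, with covariates $X_i\in\mathbb R^p$, treatment $D_i\in\{1,\dots,Q\}$, integrable potential outcomes $Y_i(d)$ and observed outcome $Y_i=Y_i(D_i)$. Write $I_d(D)$ for the indicator of $D=d$, $\pi(d|X)=P(D=d|X)$, $a(X,D)=E[Y|X,D]$. Fix a level $q$ with $Y(q)\perp I_q(D)\mid X$ and $\pi(q|X)>0$ a.s., and let $\mu(q)=E[Y(q)]$. Let $\pi^j(x,d;\alpha^j)$, $j=1,\dots,J$, be parametric propensity score models (probability mass functions in $d$) and $a^k(x,d;\beta^k)$, $k=1,\dots,K$, parametric outcome regression models, measurable in $x$ and continuous in their finite-dimensional parameters. The model $\pi^j$ is correctly specified if there is $\alpha_0$ (a true value) with $\pi^j(X,d;\alpha_0)=\pi(d|X)$ a.s. for all $d$; $a^k$ is correctly specified if there is $\beta_0$ (a true value) with $a^k(X,D;\beta_0)=a(X,D)$ a.s. The fitted parameters converge in probability, $\hat\alpha^j\to\alpha^j_*$ and $\hat\beta^k\to\beta^k_*$, and the limit is a true value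 for every model that is correctly specified. Write $\gamma=(\alpha^1,\dots,\alpha^J,\beta^1,\dots,\beta^K)$, with fitted value $\hat\gamma$ and limit $\gamma_*$, let $f(x;\gamma)\in\mathbb R^{J+K}$ be the vector with entries $\pi^j(x,q;\alpha^j)$ and $a^k(x,q;\beta^k)$, and let $|\cdot|$ denote distance for parameters. **Estimator.** Let $M_q=\{i\le n:D_i=q\}$, $m_q=|M_q|$, $\hat t=(\hat\theta^1,\dots,\hat\theta^J,\hat\eta^1,\dots,\hat\eta^K)=\frac1n\sum_{i\le n}f(X_i;\hat\gamma)$, $\hat g_i=f(X_i;\hat\gamma)-\hat t$. A root is a vector $\rho\in\mathbb R^{J+K}$ with $1+\rho^T\hat g_i\ne0$ for $i\in M_q$ and $$\sum_{i\in M_q}\frac{\hat g_i}{1+\rho^T\hat g_i}=0 .\qquad(\ast)$$ For $\hat\rho\in\mathbb R^{J+K}$ put $$\hat w_i=\frac{1}{m_q}\frac1{1+\hat\rho^T\hat g_i}\Big/\Big\{\frac{1}{m_q}\sum_{i'\in M_q}\frac1{1+\hat\rho^T\hat g_{i'}}\Big\},\qquad \hat\mu_{MR}(q)=\sum_{i\in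 M_q}\hat w_iY_i .$$ **Theorem 3.** The estimator is multiply robust for $\mu(q)$: (a) Suppose that $\pi^j$ is correctly specified and the regularity conditions (R1) below hold. Put $\hat h_i=\hat g_i/\pi^j(X_i,q;\hat\alpha^j)$. Call $\lambda$ a multiplier if $1+\lambda^T\hat h_i\neq 0$ on $M_q$, $\sum_{i\in M_q}\hat h_i/(1+\lambda^T\hat h_i)=0$, and $p_i=m_q^{-1}/(1+\lambda^T\hat h_i)$ maximises $\prod_{i\in M_q}p_i$ subject to $p_i\ge0$, $\sum_{i\in M_q} p_i=1$, $\sum_{i\in M_q} p_i\hat h_i=0$. Let $\hat\lambda$ be a multiplier whenever one exists, and let $\hat\rho^\pi$ have $j$-th entry $(\hat\lambda_j+1)/\hat\theta^j$ and other entries $\hat\lambda_l/\hat\theta^j$. Then with probability tending to one $\hat\lambda$ is a multiplier and $\hat\rho^\pi$ is a root of $(\ast)$, and $\hat\mu_{MR}(q)$ evaluated at $\hat\rho=\hat\rho^\pi$ converges to $\mu(q)$ in probability. (b) Suppose that $a^k$ is correctly specified, that $\hat\rho^a$ is, with probability tending to one, a root of $(\ast)$, that $\hat\rho^a\to\rho_*$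 in probability with $\rho_*$ finite, and that the regularity conditions (R2) below hold. Then $\hat\mu_{MR}(q)$ evaluated at $\hat\rho=\hat\rho^a$ converges to $\mu(q)$ in probability. **(R1)** $\sqrt n\,|\hat\gamma-\gamma_*|=O_p(1)$, and there are a neighbourhood $U$ of $\gamma_*$ and functions $H,B,L$ of an observation $(X,D,Y)$, with $H$ square integrable and $B,L$ integrable, such that almost surely, for all $\gamma\in U$ and all coordinates $l$: $|f_l(X;\gamma)-f_l(X;\gamma_*)|\le L|\gamma-\gamma_*|$; and, if $D=q$, also $1\le H\pi^j(X,q;\alpha^j)$, $|f_l(X;\gamma)|\le H\pi^j(X,q;\alpha^j)$, $|Y|\le B\,\pi^j(X,q;\alpha^j)$, and the functions $1/\pi^j(X,q;\alpha^j)$ and $f_l(X;\gamma)/\pi^j(X,q;\alpha^j)$ differ from their values at $\gamma_*$ by at most $L|\gamma-\gamma_*|$. Moreover, every linear combination $v^Tf(X;\gamma)$ that is a.s. constant at $\gamma=\gamma_*$ is constant for all $\gamma\in U$: there is $c:U\to\mathbb R$ such that a.s. $v^Tf(X;\gamma)=c(\gamma)$ for all $\gamma\in U$ (for instance, there is no nonzero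 such $v$). **(R2)** Let $t_*=E f(X;\gamma_*)$. The coordinates of $f(X;\gamma)$ are dominated by an integrable function of $(X,D,Y)$, uniformly over $\gamma$ in a neighbourhood of $\gamma_*$; there are an integrable $B$ of $(X,D,Y)$ and a neighbourhood of $(\gamma_*,t_*,\rho_*)$ such that a.s., if $D=q$, then $1+|Y-a^k(X,q;\beta^k)|\le B\,|1+\rho^T(f(X;\gamma)-t)|$ for all $(\gamma,t,\rho)$ in it; and $E\big[I_q(D)/\{1+\rho_*^T(f(X;\gamma_*)-t_*)\}\big]\ne0$. -/

import Mathlib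

open MeasureTheory ProbabilityTheory Filter Topology
open scoped BigOperators

noncomputable section

namespace MultiplyRobust

/-! ### Data -/

/-- An infinite sequence of units.  Unit `i` has covariates `X i`, treatment level `D i` (one of `Q`
levels) and potential outcomes `Ypot i d`, one for every level `d`. -/
structure Sample (Ω : Type*) (p Q : ℕ) where
  X : ℕ → Ω → EuclideanSpace ℝ (Fin p)
  D : ℕ → Ω → Fin Q
  Ypot : ℕ → Fin Q → Ω → ℝ

namespace Sample

variable {Ω : Type*} {p Q : ℕ} (S : Sample Ω p Q)

/-- Observed outcome: the potential outcome under the treatment received (SUTVA). -/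
def Y (i : ℕ) (ω : Ω) : ℝ := S.Ypot i (S.D i ω) ω

/-- Indicator `I_d(D_i)`. -/
def ind (d : Fin Q) (i : ℕ) (ω : Ω) : ℝ := if S.D i ω = d then 1 else 0

/-- Everything attached to unit `i`: covariates, treatment and all potential outcomes. -/
def unit (i : ℕ) (ω : Ω) : EuclideanSpace ℝ (Fin p) × Fin Q × (Fin Q → ℝ) :=
  (S.X i ω, S.D i ω, fun d => S.Ypot i d ω)

/-- The observed part `(X_i, D_i, Y_i)`. -/
def obs (i : ℕ) (ω : Ω) : EuclideanSpace ℝ (Fin p) × Fin Q × ℝ := (S.X i ω, S.D i ω, S.Y i ω)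

/-- `M_q = {i < n : D_i = q}`. -/
def arm (q : Fin Q) (n : ℕ) (ω : Ω) : Finset ℕ := (Finset.range n).filter (fun i => S.D i ω = q)

/-- The law of one observation `(X, D, Y)`. -/
def obsLaw [MeasurableSpace Ω] (P : Measure Ω) : Measure (EuclideanSpace ℝ (Fin p) × Fin Q × ℝ) :=
  P.map (S.obs 0)

/-- Average potential outcome `μ(q) = E[Y(q)]`. -/
def apo [MeasurableSpace Ω] (P : Measure Ω) (q : Fin Q) : ℝ := ∫ ω, S.Ypot 0 q ω ∂P

/-- True generalised propensity score `π(d|X) = P(D = d | X)`, as a random variable. -/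
def gps [MeasurableSpace Ω] (P : Measure Ω) (d : Fin Q) : Ω → ℝ :=
  P[S.ind d 0 | MeasurableSpace.comap (S.X 0) inferInstance]

/-- True outcome regression `a(X, D) = E[Y | X, D]`, as a random variable. -/
def outcomeReg [MeasurableSpace Ω] (P : Measure Ω) : Ω → ℝ :=
  P[S.Y 0 | MeasurableSpace.comap (fun ω => (S.X 0 ω, S.D 0 ω)) inferInstance]

/-- Standing assumptions of causal inference at the treatment level `q`: i.i.d. units with
integrable potential outcomes, no unmeasured confounding, positivity. -/
structure Identified [MeasurableSpace Ω] [StandardBorelSpace Ω] (P : Measure Ω)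
    [IsProbabilityMeasure P] (q : Fin Q) : Prop where
  measurable_X : ∀ i, Measurable (S.X i)
  measurable_D : ∀ i, Measurable (S.D i)
  measurable_Ypot : ∀ i d, Measurable (S.Ypot i d)
  indep : iIndepFun S.unit P
  ident : ∀ i, IdentDistrib (S.unit i) (S.unit 0) P P
  integrable : ∀ d, Integrable (S.Ypot 0 d) P
  unconfounded : CondIndepFun (MeasurableSpace.comap (S.X 0) inferInstance)
    (measurable_X 0).comap_le (S.Ypot 0 q) (S.ind q 0) P
  positivity : ∀ᵐ ω ∂P, 0 < S.gps P q ω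

end Sample

/-! ### Parametric models -/

/-- A parametric propensity score model `π(x, d; α)`, `α ∈ Θ ⊆ ℝ^dim`: a probability mass function
in `d`, measurable in `x` and continuous in `α`. -/
structure PSModel (p Q : ℕ) where
  dim : ℕ
  Θ : Set (EuclideanSpace ℝ (Fin dim))
  prob : EuclideanSpace ℝ (Fin p) → Fin Q → Θ → ℝ
  measurable : ∀ d α, Measurable (fun x => prob x d α)
  continuous : ∀ x d, Continuous (prob x d)
  nonneg : ∀ x d α, 0 ≤ prob x d α
  sum_eq_one : ∀ x α, ∑ d, prob x d α = 1

/-- A parametric outcome regression model `a(x, d; β)`, `β ∈ Θ ⊆ ℝ^dim`, measurable in `x` and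
continuous in `β`. -/
structure ORModel (p Q : ℕ) where
  dim : ℕ
  Θ : Set (EuclideanSpace ℝ (Fin dim))
  mean : EuclideanSpace ℝ (Fin p) → Fin Q → Θ → ℝ
  measurable : ∀ d β, Measurable (fun x => mean x d β)
  continuous : ∀ x d, Continuous (mean x d)

section Models

variable {Ω : Type*} [MeasurableSpace Ω] {p Q : ℕ}

/-- `α` is a true value: `π(X, d; α) = π(d|X)` for every level `d`, almost surely. -/
def PSModel.IsTrueValue (M : PSModel p Q) (S : Sample Ω p Q) (P : Measure Ω) (α : M.Θ) : Prop :=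
  ∀ d, (fun ω => M.prob (S.X 0 ω) d α) =ᵐ[P] S.gps P d

def PSModel.CorrectlySpecified (M : PSModel p Q) (S : Sample Ω p Q) (P : Measure Ω) : Prop :=
  ∃ α, M.IsTrueValue S P α

/-- `β` is a true value: `a(X, D; β) = E[Y | X, D]` almost surely. -/
def ORModel.IsTrueValue (M : ORModel p Q) (S : Sample Ω p Q) (P : Measure Ω) (β : M.Θ) : Prop :=
  (fun ω => M.mean (S.X 0 ω) (S.D 0 ω) β) =ᵐ[P] S.outcomeReg P

def ORModel.CorrectlySpecified (M : ORModel p Q) (S : Sample Ω p Q) (P : Measure Ω) : Prop :=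
  ∃ β, M.IsTrueValue S P β

end Models

/-- Joint parameters `(α¹, …, αᴶ, β¹, …, βᴷ)`. -/
abbrev Params {p Q J K : ℕ} (PS : Fin J → PSModel p Q) (OR : Fin K → ORModel p Q) : Type :=
  (∀ j, (PS j).Θ) × (∀ k, (OR k).Θ)

/-- Vectors of length `J + K`. -/
abbrev Vec (J K : ℕ) : Type := Fin J ⊕ Fin K → ℝ

/-! ### Empirical likelihood and the estimating equation -/

section EL

variable {J K : ℕ}

/-- `ρ` is a root of `∑_{i ∈ M} g_i / (1 + ρᵀ g_i) = 0` (all the denominators being nonzero). -/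
def IsRoot (M : Finset ℕ) (g : ℕ → Vec J K) (ρ : Vec J K) : Prop :=
  (∀ i ∈ M, 1 + ρ ⬝ᵥ g i ≠ 0) ∧ ∑ i ∈ M, (1 / (1 + ρ ⬝ᵥ g i)) • g i = 0

/-- `p_i ≥ 0`, `∑ p_i = 1`, `∑ p_i h_i = 0`. -/
def IsFeasible (M : Finset ℕ) (h : ℕ → Vec J K) (w : ℕ → ℝ) : Prop :=
  (∀ i ∈ M, 0 ≤ w i) ∧ ∑ i ∈ M, w i = 1 ∧ ∑ i ∈ M, w i • h i = 0

/-- The empirical likelihood problem: maximise `∏ p_i` over the feasible `p`. -/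
def IsELSolution (M : Finset ℕ) (h : ℕ → Vec J K) (w : ℕ → ℝ) : Prop :=
  IsFeasible M h w ∧ ∀ w', IsFeasible M h w' → ∏ i ∈ M, w' i ≤ ∏ i ∈ M, w i

/-- `lam` is a Lagrange multiplier of the empirical likelihood problem: it solves
`∑ h_i / (1 + lamᵀ h_i) = 0` and `p_i = m⁻¹ / (1 + lamᵀ h_i)` is the maximiser. -/
def IsELMultiplier (M : Finset ℕ) (h : ℕ → Vec J K) (lam : Vec J K) : Prop :=
  IsRoot M h lam ∧ IsELSolution M h (fun i => 1 / (M.card : ℝ) * (1 / (1 + lam ⬝ᵥ h i)))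

end EL

/-! ### The estimator -/

section Estimator

variable {Ω : Type*} {p Q J K : ℕ} (PS : Fin J → PSModel p Q) (OR : Fin K → ORModel p Q)
  (q : Fin Q)

/-- `(π¹(x, q; α¹), …, πᴶ(x, q; αᴶ), a¹(x, q; β¹), …, aᴷ(x, q; βᴷ))`. -/
def modelVec (γ : Params PS OR) (x : EuclideanSpace ℝ (Fin p)) : Vec J K :=
  Sum.elim (fun j => (PS j).prob x q (γ.1 j)) (fun k => (OR k).mean x q (γ.2 k))

variable (S : Sample Ω p Q)

/-- Sample means `(θ̂¹, …, θ̂ᴶ, η̂¹, …, η̂ᴷ)` of the models with parameter `γ`. -/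
def centreHat (γ : Params PS OR) (n : ℕ) (ω : Ω) : Vec J K :=
  (1 / (n : ℝ)) • ∑ i ∈ Finset.range n, modelVec PS OR q γ (S.X i ω)

/-- `ĝ_i`. -/
def gHat (γ : Params PS OR) (n : ℕ) (ω : Ω) (i : ℕ) : Vec J K :=
  modelVec PS OR q γ (S.X i ω) - centreHat PS OR q S γ n ω

/-- `ŵ_{i,q}` at `ρ`. -/
def weight (γ : Params PS OR) (ρ : Vec J K) (n : ℕ) (ω : Ω) (i : ℕ) : ℝ :=
  (1 / ((S.arm q n ω).card : ℝ) * (1 / (1 + ρ ⬝ᵥ gHat PS OR q S γ n ω i))) /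
    (1 / ((S.arm q n ω).card : ℝ) *
      ∑ i' ∈ S.arm q n ω, 1 / (1 + ρ ⬝ᵥ gHat PS OR q S γ n ω i'))

/-- `μ̂_MR(q) = ∑_{i ∈ M_q} ŵ_{i,q} Y_i`. -/
def muMR (γ : Params PS OR) (ρ : Vec J K) (n : ℕ) (ω : Ω) : ℝ :=
  ∑ i ∈ S.arm q n ω, weight PS OR q S γ ρ n ω i * S.Y i ω

/-- `ĝ_i / πʲ(q | X_i; αʲ)`. -/
def hHat (j : Fin J) (γ : Params PS OR) (n : ℕ) (ω : Ω) (i : ℕ) : Vec J K :=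
  (1 / (PS j).prob (S.X i ω) q (γ.1 j)) • gHat PS OR q S γ n ω i

/-- `ρ^π` built from `lam`: the `j`-th entry is `(lam_j + 1)/θ̂ʲ`, the `l`-th one, `l ≠ j`, is
`lam_l/θ̂ʲ`. -/
def rhoPi (j : Fin J) (γ : Params PS OR) (lam : Vec J K) (n : ℕ) (ω : Ω) : Vec J K :=
  fun l => (lam l + if l = Sum.inl j then 1 else 0) / centreHat PS OR q S γ n ω (Sum.inl j)

end Estimator

/-! ### Regularity conditions -/

section Regularity

variable {Ω : Type*} [MeasurableSpace Ω] {p Q J K : ℕ} (PS : Fin J → PSModel p Q)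
  (OR : Fin K → ORModel p Q) (q : Fin Q) (S : Sample Ω p Q) (P : Measure Ω)

/-- Population means `(θ_*, η_*)` of the models at the parameter `γ`. -/
def centre (γ : Params PS OR) : Vec J K := fun l => ∫ ω, modelVec PS OR q γ (S.X 0 ω) l ∂P

/-- `√n · dist (T_n, c)` is bounded in probability. -/
def RootNConsistent {E : Type*} [PseudoMetricSpace E] (T : ℕ → Ω → E) (c : E) : Prop :=
  ∀ ε : ℝ, 0 < ε → ∃ B : ℝ, ∀ᶠ n : ℕ in atTop,
    P {ω | B < Real.sqrt n * dist (T n ω) c} ≤ ENNReal.ofReal ε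

/-- Regularity conditions for the case in which the `j`-th propensity score model is correct.
`γ` is the limit of the fitted parameters; envelopes are functions of an observation
`z = (x, d, y)`. -/
structure RegularPS (j : Fin J) (γhat : ℕ → Ω → Params PS OR) (γ : Params PS OR) : Prop where
  rootN : RootNConsistent P γhat γ
  /-- Local moment and smoothness conditions, and non-redundancy of the moment conditions. -/
  locally_regular : ∃ U ∈ 𝓝 γ, ∃ H B L : EuclideanSpace ℝ (Fin p) × Fin Q × ℝ → ℝ,
    MemLp H 2 (S.obsLaw P) ∧ Integrable B (S.obsLaw P) ∧ Integrable L (S.obsLaw P) ∧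
    (∀ᵐ z ∂(S.obsLaw P), z.2.1 = q → ∀ γ' ∈ U,
      1 ≤ H z * (PS j).prob z.1 q (γ'.1 j) ∧
      (∀ l, |modelVec PS OR q γ' z.1 l| ≤ H z * (PS j).prob z.1 q (γ'.1 j)) ∧
      |z.2.2| ≤ B z * (PS j).prob z.1 q (γ'.1 j) ∧
      |1 / (PS j).prob z.1 q (γ'.1 j) - 1 / (PS j).prob z.1 q (γ.1 j)| ≤ L z * dist γ' γ ∧
      ∀ l, |modelVec PS OR q γ' z.1 l / (PS j).prob z.1 q (γ'.1 j) -
        modelVec PS OR q γ z.1 l / (PS j).prob z.1 q (γ.1 j)| ≤ L z * dist γ' γ) ∧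
    (∀ᵐ z ∂(S.obsLaw P), ∀ γ' ∈ U, ∀ l,
      |modelVec PS OR q γ' z.1 l - modelVec PS OR q γ z.1 l| ≤ L z * dist γ' γ) ∧
    (∀ v : Vec J K, (∃ c : ℝ, ∀ᵐ z ∂(S.obsLaw P), v ⬝ᵥ modelVec PS OR q γ z.1 = c) →
      ∃ c : Params PS OR → ℝ, ∀ᵐ z ∂(S.obsLaw P), ∀ γ' ∈ U,
        v ⬝ᵥ modelVec PS OR q γ' z.1 = c γ')

/-- Regularity conditions for the case in which the `k`-th outcome regression model is correct.
`γ` is the limit of the fitted parameters and `ρ` the limit of the root. -/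
structure RegularOR (k : Fin K) (γ : Params PS OR) (ρ : Vec J K) : Prop where
  /-- The models are locally dominated. -/
  dominated_models : ∃ U ∈ 𝓝 γ, ∃ B : EuclideanSpace ℝ (Fin p) × Fin Q × ℝ → ℝ,
    Integrable B (S.obsLaw P) ∧
    ∀ᵐ z ∂(S.obsLaw P), ∀ γ' ∈ U, ∀ l, |modelVec PS OR q γ' z.1 l| ≤ B z
  /-- `1/(1 + ρᵀg)` and `{Y - aᵏ}/(1 + ρᵀg)` are locally dominated on `D = q`. -/
  dominated_weights : ∃ U ∈ 𝓝 (γ, centre PS OR q S P γ, ρ),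
    ∃ B : EuclideanSpace ℝ (Fin p) × Fin Q × ℝ → ℝ, Integrable B (S.obsLaw P) ∧
    ∀ᵐ z ∂(S.obsLaw P), z.2.1 = q → ∀ u ∈ U,
      1 + |z.2.2 - (OR k).mean z.1 q (u.1.2 k)| ≤
        B z * |1 + u.2.2 ⬝ᵥ (modelVec PS OR q u.1 z.1 - u.2.1)|
  /-- The limit of the normalising constant of the weights does not vanish. -/
  normaliser_ne_zero :
    ∫ ω, S.ind q 0 ω / (1 + ρ ⬝ᵥ (modelVec PS OR q γ (S.X 0 ω) - centre PS OR q S P γ)) ∂P ≠ 0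

end Regularity

end MultiplyRobust

end

/-!
Convergence in probability to a constant is convergence along a filter on `ℕ × Ω`, `inProb P`,
whose sets are the events with probability tending to one. Products, quotients, finite sums and
intersections of events are then handled by the filter library, and no measurability of the fitted
parameters or of the multipliers is needed. Sample means at fitted parameters converge by a
uniform law of large numbers, `IsIID.uniform_law_large_numbers`.

Unconfoundedness is used as an identity of measures, `Sample.Identified.map_restrict_eq`:
restricting the law of `(Y(q), X)` to `D = q` is weighting it by the propensity score. It yields
the inverse probability weighting formula, the outcome regression formula, and the fact that an
identity in `X` valid on `D = q` holds almost surely.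

*Correct outcome regression.* The coordinate of the estimating equation that belongs to the
correct model says that its weighted mean over the arm equals its unweighted mean over the sample
(`IsRoot.muMR_eq`). Hence the estimator is the unweighted mean, which converges to `μ(q)`, plus a
weighted mean of residuals, which converges to zero because the limiting weights are functions of
the covariates.

*Correct propensity score.* The substitution `ρ = (λ + e_j) / θ̂ʲ` turns the estimating equation
into the equation of the empirical likelihood problem for `ĥ_i`, whose population mean is zero.
The mean of the `ĥ_i` is `O_p(n^{-1/2})`, their maximum is `o_p(n^{1/2})`, and their second moment
form is positive on the complement `V` of the degenerate directions, a space in which they lie. A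
compactness argument for the empirical log-likelihood on a small ball of `V` (`exists_isRoot`)
gives a root `λ` with `max |λᵀĥ_i| → 0`; such a root is a multiplier, and all multipliers have the
same values `λᵀĥ_i`. So the weights are asymptotically the normalised inverse propensity weights,
for which the law of large numbers gives the limit `μ(q)`.
-/

namespace MultiplyRobust

/-! ### Convergence in probability as convergence along a filter -/

section InProbability

variable {Ω : Type*} [MeasurableSpace Ω] {P : Measure Ω}

/-- The filter on `ℕ × Ω` of the events that hold with probability tending to one.  The outer
measure of the complement is used, so no measurability is required of the events. -/
def inProb (P : Measure Ω) : Filter (ℕ × Ω) where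
  sets := {A | Tendsto (fun n => P {ω | (n, ω) ∉ A}) atTop (𝓝 0)}
  univ_sets := by simp
  sets_of_superset := fun {A B} hA hAB =>
    tendsto_of_tendsto_of_tendsto_of_le_of_le tendsto_const_nhds hA (fun _ => zero_le)
      (fun n => measure_mono fun ω hω h => hω (hAB h))
  inter_sets := fun {A B} hA hB => by
    have h := Tendsto.add (f := fun n => P {ω | (n, ω) ∉ A}) hA hB
    rw [add_zero] at h
    refine tendsto_of_tendsto_of_tendsto_of_le_of_le tendsto_const_nhds h (fun _ => zero_le)
      (fun n => (measure_mono fun ω hω => ?_).trans (measure_union_le _ _))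
    simp only [Set.mem_inter_iff, not_and_or, Set.mem_ofPred_eq] at hω
    exact hω

theorem eventually_inProb {p : ℕ × Ω → Prop} :
    (∀ᶠ x in inProb P, p x) ↔ Tendsto (fun n => P {ω | ¬ p (n, ω)}) atTop (𝓝 0) := Iff.rfl

theorem tendstoInMeasure_iff_inProb {E : Type*} [PseudoEMetricSpace E] {f : ℕ → Ω → E} {c : E} :
    TendstoInMeasure P f atTop (fun _ => c) ↔
      Tendsto (fun x : ℕ × Ω => f x.1 x.2) (inProb P) (𝓝 c) := by
  rw [EMetric.tendsto_nhds]
  simp only [eventually_inProb, not_lt]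
  rfl

theorem eventually_inProb_of_ae {p : Ω → Prop} (h : ∀ᵐ ω ∂P, p ω) :
    ∀ᶠ x in inProb P, p x.2 := by
  rw [eventually_inProb]
  have : P {ω | ¬ p ω} = 0 := h
  simp [this]

theorem eventually_inProb_of_atTop {p : ℕ → Prop} (h : ∀ᶠ n in atTop, p n) :
    ∀ᶠ x in inProb P, p x.1 := by
  rw [eventually_inProb]
  refine tendsto_const_nhds.congr' ?_
  filter_upwards [h] with n hn
  simp [hn]

/-- `O_p(n^{-1/2}) · o_p(n^{1/2}) = o_p(1)`. -/
theorem RootNConsistent.tendsto_dist_mul {E : Type*} [PseudoMetricSpace E] {T : ℕ → Ω → E} {c : E}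
    (hT : RootNConsistent P T c) {M : ℕ × Ω → ℝ}
    (hM : Tendsto (fun x => M x / Real.sqrt x.1) (inProb P) (𝓝 0)) :
    Tendsto (fun x : ℕ × Ω => dist (T x.1 x.2) c * M x) (inProb P) (𝓝 0) := by
  rw [Metric.tendsto_nhds]
  intro δ hδ
  rw [eventually_inProb, ENNReal.tendsto_nhds_zero]
  intro ε hε
  obtain ⟨e, he, hee⟩ : ∃ e : ℝ, 0 < e ∧ ENNReal.ofReal e + ENNReal.ofReal e ≤ ε := by
    rcases eq_or_ne ε ⊤ with rfl | h
    · exact ⟨1, one_pos, le_top⟩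
    · refine ⟨ε.toReal / 2, half_pos (ENNReal.toReal_pos hε.ne' h), ?_⟩
      rw [← ENNReal.ofReal_add (by positivity) (by positivity), add_halves, ENNReal.ofReal_toReal h]
  obtain ⟨B, hB⟩ := hT e he
  have hB1 : 0 < max B 1 := lt_max_of_lt_right one_pos
  rw [Metric.tendsto_nhds] at hM
  have h2 := hM (δ / max B 1) (by positivity)
  rw [eventually_inProb, ENNReal.tendsto_nhds_zero] at h2
  filter_upwards [hB, h2 (ENNReal.ofReal e) (by simpa using he), eventually_gt_atTop 0]
    with n h1 h3 hn
  refine le_trans ((measure_mono ?_).trans (measure_union_le _ _)) ((add_le_add h1 h3).trans hee)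
  intro ω hω
  by_contra hcon
  simp only [Set.mem_union, Set.mem_ofPred_eq, not_or, not_lt] at hcon
  apply hω
  obtain ⟨ha, hb⟩ := hcon
  have hs : 0 < Real.sqrt n := Real.sqrt_pos.2 (by exact_mod_cast hn)
  simp only [Real.dist_eq, sub_zero, abs_mul, abs_div, abs_of_pos hs,
    abs_of_nonneg dist_nonneg, not_le] at hb ⊢
  calc dist (T n ω) c * |M (n, ω)|
      = (Real.sqrt n * dist (T n ω) c) * (|M (n, ω)| / Real.sqrt n) := by field_simp
    _ ≤ max B 1 * (|M (n, ω)| / Real.sqrt n) := by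
        gcongr; exact ha.trans (le_max_left _ _)
    _ < max B 1 * (δ / max B 1) := by gcongr
    _ = δ := by field_simp

end InProbability

/-! ### Limit theorems for i.i.d. samples -/

section RunningMax

variable {Ω E : Type*}

/-- `max_{i < n} |H (Z i)|`. -/
noncomputable def runningMax (H : E → ℝ) (Z : ℕ → Ω → E) (x : ℕ × Ω) : ℝ :=
  ((Finset.range x.1).sup fun i => ‖H (Z i x.2)‖₊ : NNReal)

theorem runningMax_nonneg (H : E → ℝ) (Z : ℕ → Ω → E) (x : ℕ × Ω) : 0 ≤ runningMax H Z x :=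
  NNReal.coe_nonneg _

theorem abs_le_runningMax (H : E → ℝ) (Z : ℕ → Ω → E) {x : ℕ × Ω} {i : ℕ} (hi : i < x.1) :
    |H (Z i x.2)| ≤ runningMax H Z x := by
  have h := Finset.le_sup (f := fun i => ‖H (Z i x.2)‖₊) (Finset.mem_range.2 hi)
  exact_mod_cast h

end RunningMax

section IID

variable {Ω E : Type*} [MeasurableSpace Ω] [MeasurableSpace E]

/-- The random elements `Z 0, Z 1, …` are independent and identically distributed. -/
structure IsIID (P : Measure Ω) (Z : ℕ → Ω → E) : Prop where
  measurable : ∀ i, Measurable (Z i)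
  indep : iIndepFun Z P
  ident : ∀ i, IdentDistrib (Z i) (Z 0) P P

variable {P : Measure Ω} {Z : ℕ → Ω → E}

theorem IsIID.comp {F : Type*} [MeasurableSpace F] (hZ : IsIID P Z) {φ : E → F}
    (hφ : Measurable φ) : IsIID P (fun i ω => φ (Z i ω)) :=
  ⟨fun i => hφ.comp (hZ.measurable i), hZ.indep.comp (fun _ => φ) (fun _ => hφ),
    fun i => (hZ.ident i).comp hφ⟩

theorem IsIID.ae_forall (hZ : IsIID P Z) {p : E → Prop} (h : ∀ᵐ z ∂(P.map (Z 0)), p z) :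
    ∀ᵐ ω ∂P, ∀ i, p (Z i ω) := by
  rw [ae_all_iff]
  intro i
  rw [← (hZ.ident i).map_eq] at h
  exact ae_of_ae_map (hZ.measurable i).aemeasurable h

variable [IsProbabilityMeasure P]

theorem IsIID.law_large_numbers (hZ : IsIID P Z) {φ : E → ℝ}
    (hφ : Integrable φ (P.map (Z 0))) :
    Tendsto (fun x : ℕ × Ω => (∑ i ∈ Finset.range x.1, φ (Z i x.2)) / x.1) (inProb P)
      (𝓝 (∫ z, φ z ∂(P.map (Z 0)))) := by
  -- pass to a measurable version of `φ`
  set ψ := hφ.1.mk φ with hψ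
  have hm : Measurable ψ := hφ.1.stronglyMeasurable_mk.measurable
  have heq : φ =ᵐ[P.map (Z 0)] ψ := hφ.1.ae_eq_mk
  have hI := hZ.comp hm
  have hint : Integrable (fun ω => ψ (Z 0 ω)) P :=
    ((integrable_congr heq).1 hφ).comp_measurable (hZ.measurable 0)
  rw [integral_congr_ae heq, integral_map (hZ.measurable 0).aemeasurable hm.aestronglyMeasurable]
  have h : Tendsto (fun x : ℕ × Ω => (∑ i ∈ Finset.range x.1, ψ (Z i x.2)) / x.1) (inProb P)
      (𝓝 (∫ ω, ψ (Z 0 ω) ∂P)) := by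
    refine tendstoInMeasure_iff_inProb
      (f := fun n ω => (∑ i ∈ Finset.range n, ψ (Z i ω)) / n).1 ?_
    refine tendstoInMeasure_of_tendsto_ae (fun n => ?_)
      (strong_law_ae_real _ hint (fun i j hij => hI.indep.indepFun hij) hI.ident)
    exact ((Finset.measurable_fun_sum _ fun i _ =>
      hI.measurable i).div_const _).aestronglyMeasurable
  refine h.congr' ?_
  filter_upwards [eventually_inProb_of_ae (hZ.ae_forall heq)] with x hx
  rw [Finset.sum_congr rfl fun i _ => hx i]

theorem IsIID.sq_integrable_mean_rootN (hZ : IsIID P Z) {φ : E → ℝ} (hm : Measurable φ)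
    (hφ : MemLp φ 2 (P.map (Z 0))) :
    RootNConsistent P (fun n ω => (∑ i ∈ Finset.range n, φ (Z i ω)) / n)
      (∫ z, φ z ∂(P.map (Z 0))) := by
  intro ε hε
  have hI := hZ.comp hm
  have hL : ∀ i, MemLp (fun ω => φ (Z i ω)) 2 P := fun i => by
    rw [← (hZ.ident i).map_eq] at hφ
    exact (memLp_map_measure_iff hφ.1 (hZ.measurable i).aemeasurable).1 hφ
  set V := variance (fun ω => φ (Z 0 ω)) P with hV
  have hV0 : 0 ≤ V := variance_nonneg _ _
  set m := ∫ z, φ z ∂(P.map (Z 0)) with hm'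
  have hmi : ∀ i, ∫ ω, φ (Z i ω) ∂P = m := fun i => by
    rw [hm', integral_map (hZ.measurable 0).aemeasurable hm.aestronglyMeasurable]
    exact (hI.ident i).integral_eq
  set B := Real.sqrt (V / ε) + 1 with hBdef
  have hB0 : 0 < B := by positivity
  have hBV : V / B ^ 2 ≤ ε := by
    rw [div_le_iff₀ (by positivity)]
    have h1 : V / ε ≤ B ^ 2 := by
      calc V / ε = Real.sqrt (V / ε) ^ 2 := (Real.sq_sqrt (by positivity)).symm
        _ ≤ B ^ 2 := by gcongr; linarith
    rw [div_le_iff₀ hε] at h1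
    linarith
  refine ⟨B, ?_⟩
  filter_upwards [eventually_gt_atTop 0] with n hn
  have hn' : (0 : ℝ) < n := by exact_mod_cast hn
  have hs : 0 < Real.sqrt n := Real.sqrt_pos.2 hn'
  set X : Ω → ℝ := ∑ i ∈ Finset.range n, fun ω => φ (Z i ω) with hX
  have hXL : MemLp X 2 P := memLp_finsetSum' _ fun i _ => hL i
  have hXm : ∫ ω, X ω ∂P = n * m := by
    simp only [hX, Finset.sum_apply]
    rw [integral_finsetSum _ fun i _ => (hL i).integrable (by norm_num)]
    simp [hmi]
  have hXV : variance X P = n * V := by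
    rw [hX, IndepFun.variance_sum (fun i _ => hL i)
      (fun i _ j _ hij => hI.indep.indepFun hij)]
    rw [Finset.sum_congr rfl fun i _ => (hI.ident i).variance_eq]
    simp [hV]
  have hc : 0 < B * Real.sqrt n := by positivity
  refine le_trans (measure_mono ?_) ((meas_ge_le_variance_div_sq hXL hc).trans
    (ENNReal.ofReal_le_ofReal ?_))
  · intro ω hω
    simp only [Set.mem_ofPred_eq] at hω ⊢
    rw [hXm]
    have h1 : (∑ i ∈ Finset.range n, φ (Z i ω)) / n - m = (X ω - n * m) / n := by
      simp only [hX, Finset.sum_apply]; field_simp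
    rw [Real.dist_eq, h1, abs_div, abs_of_pos hn'] at hω
    have h2 : B * Real.sqrt n * Real.sqrt n < Real.sqrt n * |X ω - n * m| := by
      rw [mul_assoc, Real.mul_self_sqrt hn'.le]
      rw [← mul_div_assoc, lt_div_iff₀ hn'] at hω
      exact hω
    nlinarith
  · rw [hXV, mul_pow, Real.sq_sqrt hn'.le]
    refine le_trans (le_of_eq ?_) hBV
    field_simp

/-- The maximum of `n` i.i.d. square integrable variables is `o_p(√n)`: by Markov's inequality
`n P(|H| > ε √n) ≤ ε⁻² E[H²; |H| > ε √n] → 0`. -/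
theorem IsIID.eventually_le_mul_sqrt (hZ : IsIID P Z) {H : E → ℝ}
    (hH : MemLp H 2 (P.map (Z 0))) {ε : ℝ} (hε : 0 < ε) :
    ∀ᶠ x in inProb P, ∀ i ∈ Finset.range x.1, |H (Z i x.2)| ≤ ε * Real.sqrt x.1 := by
  set ν := P.map (Z 0) with hν
  have : IsProbabilityMeasure ν := Measure.isProbabilityMeasure_map (hZ.measurable 0).aemeasurable
  set A : ℕ → Set E := fun n => {z | ε * Real.sqrt n < |H z|} with hA
  have hAm : ∀ n, NullMeasurableSet (A n) ν := fun n =>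
    nullMeasurableSet_lt aemeasurable_const hH.1.aemeasurable.abs
  have hH2 : Integrable (fun z => H z ^ 2) ν := hH.integrable_sq
  have hlim : Tendsto (fun n => ∫ z, (A n).indicator (fun z => H z ^ 2) z ∂ν) atTop (𝓝 0) := by
    have h0 : (0 : ℝ) = ∫ _ : E, (0 : ℝ) ∂ν := by simp
    rw [h0]
    refine tendsto_integral_of_dominated_convergence (fun z => H z ^ 2)
      (fun n => (hH2.1.indicator₀ (hAm n))) hH2 (fun n => ae_of_all _ fun z => ?_)
      (ae_of_all _ fun z => ?_)
    · refine (norm_indicator_le_norm_self _ _).trans ?_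
      rw [Real.norm_of_nonneg (sq_nonneg _)]
    · have h1 : Tendsto (fun n : ℕ => ε * Real.sqrt n) atTop atTop :=
        ((Real.tendsto_sqrt_atTop.comp tendsto_natCast_atTop_atTop).const_mul_atTop hε)
      refine tendsto_const_nhds.congr' ?_
      filter_upwards [h1.eventually_ge_atTop |H z|] with n hn
      rw [Set.indicator_of_notMem]
      simpa [hA] using hn
  have hlim' := ENNReal.tendsto_ofReal (hlim.div_const (ε ^ 2))
  rw [zero_div, ENNReal.ofReal_zero] at hlim'
  rw [eventually_inProb]
  refine tendsto_of_tendsto_of_tendsto_of_le_of_le' tendsto_const_nhds hlim'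
    (Eventually.of_forall fun _ => zero_le) ?_
  filter_upwards [eventually_gt_atTop 0] with n hn
  have hn' : (0 : ℝ) < n := by exact_mod_cast hn
  have hmark : (n : ℝ) * ν.real (A n) ≤
      (∫ z, (A n).indicator (fun z => H z ^ 2) z ∂ν) / ε ^ 2 := by
    rw [le_div_iff₀ (by positivity), integral_indicator₀ (hAm n)]
    have h1 : ∫ _z in A n, (ε ^ 2 * n) ∂ν ≤ ∫ z in A n, H z ^ 2 ∂ν := by
      refine setIntegral_mono_on₀ (integrable_const _) hH2.integrableOn (hAm n) fun z hz => ?_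
      have hz' : ε * Real.sqrt n < |H z| := hz
      calc ε ^ 2 * n = (ε * Real.sqrt n) ^ 2 := by rw [mul_pow, Real.sq_sqrt hn'.le]
        _ ≤ |H z| ^ 2 := by gcongr
        _ = H z ^ 2 := sq_abs _
    rw [setIntegral_const, smul_eq_mul] at h1
    linarith
  calc P {ω | ¬ ∀ i ∈ Finset.range n, |H (Z i ω)| ≤ ε * Real.sqrt n}
      ≤ P (⋃ i ∈ Finset.range n, Z i ⁻¹' A n) := by
        refine measure_mono fun ω hω => ?_
        simp only [Set.mem_ofPred_eq, not_forall, not_le] at hω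
        obtain ⟨i, hi, h⟩ := hω
        simp only [Set.mem_iUnion]
        exact ⟨i, hi, h⟩
    _ ≤ ∑ i ∈ Finset.range n, P (Z i ⁻¹' A n) := measure_biUnion_finset_le _ _
    _ ≤ ∑ _i ∈ Finset.range n, ν (A n) := Finset.sum_le_sum fun i _ => by
        rw [hν, ← (hZ.ident i).map_eq]
        exact Measure.le_map_apply (hZ.measurable i).aemeasurable _
    _ = ENNReal.ofReal (n * ν.real (A n)) := by
        rw [ENNReal.ofReal_mul hn'.le]; simp
    _ ≤ _ := ENNReal.ofReal_le_ofReal hmark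

theorem IsIID.tendsto_runningMax_div_sqrt (hZ : IsIID P Z) {H : E → ℝ}
    (hH : MemLp H 2 (P.map (Z 0))) :
    Tendsto (fun x => runningMax H Z x / Real.sqrt x.1) (inProb P) (𝓝 0) := by
  rw [Metric.tendsto_nhds]
  intro ε hε
  filter_upwards [hZ.eventually_le_mul_sqrt hH (half_pos hε),
    eventually_inProb_of_atTop (eventually_gt_atTop 0)] with x hx hn
  have hs : 0 < Real.sqrt x.1 := Real.sqrt_pos.2 (by exact_mod_cast hn)
  have h1 : runningMax H Z x ≤ ε / 2 * Real.sqrt x.1 := by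
    have h2 : ((Finset.range x.1).sup fun i => ‖H (Z i x.2)‖₊) ≤
        (⟨ε / 2 * Real.sqrt x.1, by positivity⟩ : NNReal) := Finset.sup_le fun i hi => hx i hi
    exact_mod_cast h2
  rw [Real.dist_eq, sub_zero, abs_of_nonneg (div_nonneg (runningMax_nonneg H Z x) hs.le),
    div_lt_iff₀ hs]
  nlinarith

/-- Uniform law of large numbers, in the form in which it is used: sample means of `φ u`, at random
parameters converging in probability to `u₀`, converge to the expectation of `φ u₀`.  The supremum
of the oscillation of `φ` over a small ball is measurable, because by continuity a countable dense
set of parameters suffices; its expectation tends to zero with the radius. -/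
theorem IsIID.uniform_law_large_numbers (hZ : IsIID P Z) {T : Type*} [PseudoMetricSpace T]
    [TopologicalSpace.SeparableSpace T] {φ : T → E → ℝ} (hm : ∀ u, Measurable (φ u)) {u₀ : T}
    {U : Set T} (hU : U ∈ 𝓝 u₀) {B : E → ℝ} (hB : Integrable B (P.map (Z 0)))
    (hdom : ∀ᵐ z ∂(P.map (Z 0)), ∀ u ∈ U, |φ u z| ≤ B z)
    (hcont : ∀ᵐ z ∂(P.map (Z 0)), ContinuousOn (fun u => φ u z) U)
    {u : ℕ × Ω → T} (hu : Tendsto u (inProb P) (𝓝 u₀)) :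
    Tendsto (fun x : ℕ × Ω => (∑ i ∈ Finset.range x.1, φ (u x) (Z i x.2)) / x.1) (inProb P)
      (𝓝 (∫ z, φ u₀ z ∂(P.map (Z 0)))) := by
  set ν := P.map (Z 0) with hν
  obtain ⟨r, hr, hrU⟩ := Metric.mem_nhds_iff.1 hU
  have : Nonempty T := ⟨u₀⟩
  set d := TopologicalSpace.denseSeq T with hd
  set R : ℕ → ℝ := fun k => r / (k + 1) with hR
  have hR0 : ∀ k, 0 < R k := fun k => by positivity
  have hRr : ∀ k, R k ≤ r := fun k => by
    rw [hR]; simp only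
    rw [div_le_iff₀ (by positivity)]
    nlinarith [(Nat.cast_nonneg k : (0 : ℝ) ≤ k)]
  have hRlim : Tendsto R atTop (𝓝 0) := by
    have := (tendsto_one_div_add_atTop_nhds_zero_nat (𝕜 := ℝ)).const_mul r
    simpa [hR, div_eq_mul_inv] using this
  have hu₀ : u₀ ∈ U := mem_of_mem_nhds hU
  set D : ℕ → E → ENNReal := fun k z =>
    ⨆ m, if dist (d m) u₀ < R k then ‖φ (d m) z - φ u₀ z‖ₑ else 0 with hD
  have hDm : ∀ k, Measurable (D k) := fun k => by
    refine Measurable.iSup fun m => ?_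
    by_cases h : dist (d m) u₀ < R k
    · simp only [h, if_true]
      exact ((hm _).sub (hm _)).enorm
    · simp only [h, if_false]
      exact measurable_const
  have hDle : ∀ k z c, (∀ w, dist w u₀ < R k → |φ w z - φ u₀ z| ≤ c) →
      D k z ≤ ENNReal.ofReal c := by
    intro k z c h
    refine iSup_le fun m => ?_
    split_ifs with h1
    · rw [← ofReal_norm]
      exact ENNReal.ofReal_le_ofReal (h _ h1)
    · exact zero_le
  have hDB : ∀ k, ∀ᵐ z ∂ν, D k z ≤ ENNReal.ofReal (2 * B z) := fun k => by
    filter_upwards [hdom] with z hz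
    refine hDle k z _ fun w hw => ?_
    have h1 := hz w (hrU (hw.trans_le (hRr k)))
    have h2 := hz u₀ hu₀
    have := abs_sub (φ w z) (φ u₀ z)
    linarith
  -- off a null set, `D k` bounds the oscillation over the whole ball, not only over the dense set
  have hosc : ∀ k, ∀ᵐ z ∂ν, ∀ w, dist w u₀ < R k → |φ w z - φ u₀ z| ≤ (D k z).toReal := by
    intro k
    filter_upwards [hcont, hDB k] with z hz hDz w hw
    have hopen : IsOpen (Metric.ball u₀ (R k)) := Metric.isOpen_ball
    have hcl : w ∈ closure (Metric.ball u₀ (R k) ∩ Set.range d) :=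
      (TopologicalSpace.denseRange_denseSeq T).open_subset_closure_inter hopen hw
    have hne : (𝓝[Metric.ball u₀ (R k) ∩ Set.range d] w).NeBot :=
      mem_closure_iff_nhdsWithin_neBot.1 hcl
    have hcw : ContinuousAt (fun u => φ u z) w := by
      refine hz.continuousAt (Filter.mem_of_superset (hopen.mem_nhds hw) fun v hv => hrU ?_)
      exact lt_of_lt_of_le hv (hRr k)
    have ht : Tendsto (fun v => |φ v z - φ u₀ z|) (𝓝[Metric.ball u₀ (R k) ∩ Set.range d] w)
        (𝓝 |φ w z - φ u₀ z|) :=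
      ((hcw.sub continuousAt_const).abs).tendsto.mono_left nhdsWithin_le_nhds
    refine le_of_tendsto ht ?_
    filter_upwards [self_mem_nhdsWithin] with v hv
    obtain ⟨hv1, m, rfl⟩ := hv
    rw [← ENNReal.ofReal_le_iff_le_toReal (ne_top_of_le_ne_top ENNReal.ofReal_ne_top hDz)]
    refine le_trans (le_of_eq ?_) (le_iSup _ m)
    rw [if_pos (Metric.mem_ball.1 hv1), ← ofReal_norm, Real.norm_eq_abs]
  have hDreal : ∀ k, ∀ᵐ z ∂ν, ‖(D k z).toReal‖ ≤ ‖2 * B z‖ := fun k => by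
    filter_upwards [hDB k] with z hz
    rw [Real.norm_of_nonneg ENNReal.toReal_nonneg]
    refine ENNReal.toReal_le_of_le_ofReal (norm_nonneg _) (hz.trans ?_)
    exact ENNReal.ofReal_le_ofReal (le_abs_self _)
  have hDint : ∀ k, Integrable (fun z => (D k z).toReal) ν := fun k =>
    (hB.const_mul 2).mono (hDm k).ennreal_toReal.aestronglyMeasurable (hDreal k)
  have hDlim : Tendsto (fun k => ∫ z, (D k z).toReal ∂ν) atTop (𝓝 0) := by
    have h0 : (0 : ℝ) = ∫ _ : E, (0 : ℝ) ∂ν := by simp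
    rw [h0]
    refine tendsto_integral_of_dominated_convergence (fun z => ‖2 * B z‖)
      (fun k => (hDint k).1) (hB.const_mul 2).norm hDreal ?_
    filter_upwards [hcont] with z hz
    rw [Metric.tendsto_nhds]
    intro ε hε
    have hc := Metric.tendsto_nhds.1 (hz.continuousAt hU).tendsto (ε / 2) (half_pos hε)
    obtain ⟨η, hη, hηs⟩ := Metric.eventually_nhds_iff.1 hc
    filter_upwards [hRlim.eventually_lt_const hη] with k hk
    rw [Real.dist_eq, sub_zero, abs_of_nonneg ENNReal.toReal_nonneg]
    refine lt_of_le_of_lt ?_ (half_lt_self hε)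
    refine ENNReal.toReal_le_of_le_ofReal (half_pos hε).le (hDle k z _ fun w hw => ?_)
    have := hηs (hw.trans hk)
    rw [Real.dist_eq] at this
    exact this.le
  have hB0 : Integrable (φ u₀) ν := by
    refine hB.mono (hm u₀).aestronglyMeasurable ?_
    filter_upwards [hdom] with z hz
    exact (hz u₀ hu₀).trans (le_abs_self _)
  have hmain := hZ.law_large_numbers hB0
  rw [Metric.tendsto_nhds] at hmain ⊢
  intro ε hε
  obtain ⟨k, hk⟩ := (hDlim.eventually_lt_const (half_pos hε)).exists
  have hDl := (hZ.law_large_numbers (hDint k)).eventually_lt_const hk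
  filter_upwards [hmain (ε / 2) (half_pos hε), hDl,
    eventually_inProb_of_ae (hZ.ae_forall (hosc k)),
    Metric.tendsto_nhds.1 hu (R k) (hR0 k)] with x h1 h2 h3 h4
  have h5 : dist ((∑ i ∈ Finset.range x.1, φ (u x) (Z i x.2)) / x.1)
      ((∑ i ∈ Finset.range x.1, φ u₀ (Z i x.2)) / x.1) ≤
      (∑ i ∈ Finset.range x.1, (D k (Z i x.2)).toReal) / x.1 := by
    rw [Real.dist_eq, ← sub_div, ← Finset.sum_sub_distrib, abs_div, Nat.abs_cast]
    gcongr
    exact (Finset.abs_sum_le_sum_abs _ _).trans (Finset.sum_le_sum fun i _ => h3 i _ h4)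
  linarith [dist_triangle ((∑ i ∈ Finset.range x.1, φ (u x) (Z i x.2)) / x.1)
      ((∑ i ∈ Finset.range x.1, φ u₀ (Z i x.2)) / x.1) (∫ z, φ u₀ z ∂ν)]

end IID

/-! ### Identification of the mean potential outcome -/

section Indicator

variable {Ω : Type*} {p Q : ℕ}

theorem Sample.ind_eq_indicator (S : Sample Ω p Q) (d : Fin Q) (i : ℕ) :
    S.ind d i = {ω | S.D i ω = d}.indicator 1 := by
  funext ω
  simp [Sample.ind, Set.indicator_apply]

theorem Sample.abs_ind_le (S : Sample Ω p Q) (d : Fin Q) (i : ℕ) (ω : Ω) : |S.ind d i ω| ≤ 1 := by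
  unfold Sample.ind; split_ifs <;> simp

theorem Sample.ind_mul_Y (S : Sample Ω p Q) (q : Fin Q) (φ : ℝ → ℝ) (i : ℕ) (ω : Ω) :
    S.ind q i ω * φ (S.Y i ω) = S.ind q i ω * φ (S.Ypot i q ω) := by
  unfold Sample.ind Sample.Y
  split_ifs with h
  · rw [h]
  · simp

end Indicator

/-- The `σ`-algebra generated by the covariates of a unit. -/
abbrev Sample.covariateSigma {Ω : Type*} {p Q : ℕ} (S : Sample Ω p Q) : MeasurableSpace Ω :=
  MeasurableSpace.comap (S.X 0) inferInstance

/-- The `σ`-algebra generated by the covariates and the treatment of a unit. -/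
abbrev Sample.treatmentSigma {Ω : Type*} {p Q : ℕ} (S : Sample Ω p Q) : MeasurableSpace Ω :=
  MeasurableSpace.comap (fun ω => (S.X 0 ω, S.D 0 ω)) inferInstance

theorem Sample.gps_stronglyMeasurable {Ω : Type*} [MeasurableSpace Ω] {p Q : ℕ} (S : Sample Ω p Q)
    (P : Measure Ω) (d : Fin Q) : StronglyMeasurable[S.covariateSigma] (S.gps P d) :=
  stronglyMeasurable_condExp

section Identification

variable {Ω : Type*} [MeasurableSpace Ω] [StandardBorelSpace Ω] {P : Measure Ω}
  [IsProbabilityMeasure P] {p Q : ℕ} {S : Sample Ω p Q} {q : Fin Q}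

theorem measurable_observe : Measurable
    (fun u : EuclideanSpace ℝ (Fin p) × Fin Q × (Fin Q → ℝ) => (u.1, u.2.1, u.2.2 u.2.1)) := by
  refine measurable_fst.prodMk (measurable_snd.fst.prodMk ?_)
  have h : Measurable (fun v : (Fin Q → ℝ) × Fin Q => v.1 v.2) :=
    measurable_from_prod_countable_left fun d => measurable_pi_apply d
  exact h.comp (measurable_snd.snd.prodMk measurable_snd.fst)

theorem Sample.Identified.isIID_obs (hS : S.Identified P q) : IsIID P S.obs := by
  have hu : IsIID P S.unit :=
    ⟨fun i => (hS.measurable_X i).prodMk ((hS.measurable_D i).prodMk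
      (measurable_pi_lambda _ fun d => hS.measurable_Ypot i d)), hS.indep, hS.ident⟩
  exact hu.comp measurable_observe

theorem Sample.Identified.measurable_obs (hS : S.Identified P q) (i : ℕ) : Measurable (S.obs i) :=
  hS.isIID_obs.measurable i

theorem Sample.Identified.measurable_Y (hS : S.Identified P q) (i : ℕ) : Measurable (S.Y i) :=
  (measurable_snd.snd).comp (hS.measurable_obs i)

theorem Sample.Identified.measurableSet_treated (hS : S.Identified P q) (d : Fin Q) (i : ℕ) :
    MeasurableSet {ω | S.D i ω = d} := hS.measurable_D i (measurableSet_singleton d)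

theorem Sample.Identified.measurable_ind (hS : S.Identified P q) (d : Fin Q) (i : ℕ) :
    Measurable (S.ind d i) :=
  Measurable.ite (hS.measurableSet_treated d i) measurable_const measurable_const

theorem Sample.Identified.integrable_ind (hS : S.Identified P q) (d : Fin Q) (i : ℕ) :
    Integrable (S.ind d i) P :=
  Integrable.of_bound (hS.measurable_ind d i).aestronglyMeasurable 1
    (ae_of_all _ fun ω => S.abs_ind_le d i ω)

theorem Sample.Identified.gps_nonneg (hS : S.Identified P q) : ∀ᵐ ω ∂P, 0 ≤ S.gps P q ω := by
  filter_upwards [hS.positivity] with ω h using h.le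

theorem Sample.Identified.gps_le_one (hS : S.Identified P q) : ∀ᵐ ω ∂P, S.gps P q ω ≤ 1 := by
  have h : S.gps P q ≤ᵐ[P] P[fun _ => (1 : ℝ) | MeasurableSpace.comap (S.X 0) inferInstance] :=
    condExp_mono (hS.integrable_ind q 0) (integrable_const _)
      (ae_of_all _ fun ω => (le_abs_self _).trans (S.abs_ind_le q 0 ω))
  rw [condExp_const (hS.measurable_X 0).comap_le] at h
  exact h

theorem Sample.Identified.integrable_Y (hS : S.Identified P q) : Integrable (S.Y 0) P := by
  have h : S.Y 0 = fun ω => ∑ d, S.ind d 0 ω * S.Ypot 0 d ω := by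
    funext ω
    simp [Sample.Y, Sample.ind]
  rw [h]
  exact integrable_finsetSum _ fun d _ => (hS.integrable d).bdd_mul
    (hS.measurable_ind d 0).aestronglyMeasurable (ae_of_all _ fun ω => S.abs_ind_le d 0 ω)

theorem Sample.Identified.measurable_gps (hS : S.Identified P q) (d : Fin Q) :
    Measurable (S.gps P d) :=
  ((S.gps_stronglyMeasurable P d).mono (hS.measurable_X 0).comap_le).measurable

/-- Unconfoundedness as an identity of measures: for the joint law of `Y(q)` and `X`, restricting
to the units with `D = q` amounts to weighting by the propensity score. -/
theorem Sample.Identified.map_restrict_eq (hS : S.Identified P q) :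
    (P.restrict {ω | S.D 0 ω = q}).map (fun ω => (S.Ypot 0 q ω, S.X 0 ω)) =
      (P.withDensity fun ω => ENNReal.ofReal (S.gps P q ω)).map
        (fun ω => (S.Ypot 0 q ω, S.X 0 ω)) := by
  have hpair : Measurable (fun ω => (S.Ypot 0 q ω, S.X 0 ω)) :=
    (hS.measurable_Ypot 0 q).prodMk (hS.measurable_X 0)
  have hmle : S.covariateSigma ≤ ‹MeasurableSpace Ω› := (hS.measurable_X 0).comap_le
  have hgi : Integrable (S.gps P q) P := integrable_condExp
  refine Measure.ext_prod fun {s t} hs ht => ?_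
  have hA : MeasurableSet (S.Ypot 0 q ⁻¹' s) := hS.measurable_Ypot 0 q hs
  have hT : MeasurableSet[S.covariateSigma] (S.X 0 ⁻¹' t) := ⟨t, ht, rfl⟩
  have hDm := hS.measurableSet_treated q 0
  rw [Measure.map_apply hpair (hs.prod ht), Measure.map_apply hpair (hs.prod ht),
    Measure.restrict_apply (hpair (hs.prod ht)), withDensity_apply _ (hpair (hs.prod ht))]
  have hset : (fun ω => (S.Ypot 0 q ω, S.X 0 ω)) ⁻¹' s ×ˢ t =
      S.Ypot 0 q ⁻¹' s ∩ S.X 0 ⁻¹' t := by ext ω; simp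
  rw [hset]
  have hci := (condIndepFun_iff_condExp_inter_preimage_eq_mul (hS.measurable_Ypot 0 q)
    (hS.measurable_ind q 0)).1 hS.unconfounded s {1} hs (measurableSet_singleton 1)
  have hind1 : S.ind q 0 ⁻¹' {1} = {ω | S.D 0 ω = q} := by
    ext ω; simp [Sample.ind]
  rw [hind1] at hci
  have hgps : S.gps P q = P⟦{ω | S.D 0 ω = q} | S.covariateSigma⟧ := by
    rw [Sample.gps, S.ind_eq_indicator]; rfl
  rw [← hgps] at hci
  set F : Ω → ℝ := (S.Ypot 0 q ⁻¹' s).indicator (fun _ => (1 : ℝ)) with hF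
  have hFi : Integrable F P := (integrable_const _).indicator hA
  have hFg : Integrable (F * S.gps P q) P := by
    refine hgi.bdd_mul (c := 1) hFi.1 (ae_of_all _ fun ω => ?_)
    by_cases h : ω ∈ S.Ypot 0 q ⁻¹' s <;> simp [hF, h]
  have hpull : P[F * S.gps P q | S.covariateSigma] =ᵐ[P] P[F | S.covariateSigma] * S.gps P q :=
    condExp_mul_of_stronglyMeasurable_right (S.gps_stronglyMeasurable P q) hFg hFi
  have key : ∫ ω in S.X 0 ⁻¹' t, (S.Ypot 0 q ⁻¹' s ∩ {ω | S.D 0 ω = q}).indicator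
      (fun _ => (1 : ℝ)) ω ∂P = ∫ ω in S.X 0 ⁻¹' t, (F * S.gps P q) ω ∂P := by
    rw [← setIntegral_condExp hmle ((integrable_const _).indicator (hA.inter hDm)) hT,
      ← setIntegral_condExp hmle hFg hT]
    refine integral_congr_ae (ae_restrict_of_ae ?_)
    filter_upwards [hci, hpull] with ω h1 h2
    rw [h1, h2]; rfl
  have hTm := hmle _ hT
  rw [integral_indicator_const _ (hA.inter hDm)] at key
  have hR : ∫ ω in S.X 0 ⁻¹' t, (F * S.gps P q) ω ∂P =
      ∫ ω in S.Ypot 0 q ⁻¹' s ∩ S.X 0 ⁻¹' t, S.gps P q ω ∂P := by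
    have : F * S.gps P q = (S.Ypot 0 q ⁻¹' s).indicator (S.gps P q) := by
      funext ω
      by_cases h : ω ∈ S.Ypot 0 q ⁻¹' s <;> simp [hF, h]
    rw [this, integral_indicator hA, Measure.restrict_restrict hA]
  rw [hR] at key
  rw [← ofReal_integral_eq_lintegral_ofReal hgi.integrableOn (ae_restrict_of_ae hS.gps_nonneg),
    ← key]
  simp only [smul_eq_mul, mul_one]
  rw [ofReal_measureReal, Measure.restrict_apply (hA.inter hDm)]
  congr 1
  ext ω; simp; tauto

theorem Sample.Identified.integrable_ind_iff (hS : S.Identified P q)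
    {φ : ℝ × EuclideanSpace ℝ (Fin p) → ℝ} (hφ : Measurable φ) :
    Integrable (fun ω => S.ind q 0 ω * φ (S.Y 0 ω, S.X 0 ω)) P ↔
      Integrable (fun ω => S.gps P q ω * φ (S.Ypot 0 q ω, S.X 0 ω)) P := by
  have hpair : Measurable (fun ω => (S.Ypot 0 q ω, S.X 0 ω)) :=
    (hS.measurable_Ypot 0 q).prodMk (hS.measurable_X 0)
  have h1 : (fun ω => S.ind q 0 ω * φ (S.Y 0 ω, S.X 0 ω)) =
      {ω | S.D 0 ω = q}.indicator (fun ω => φ (S.Ypot 0 q ω, S.X 0 ω)) := by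
    funext ω
    rw [S.ind_mul_Y q (fun y => φ (y, S.X 0 ω)), S.ind_eq_indicator]
    simp [Set.indicator_apply]
  rw [h1, integrable_indicator_iff (hS.measurableSet_treated q 0), IntegrableOn]
  have h2 := integrable_map_measure (μ := P.restrict {ω | S.D 0 ω = q})
    (f := fun ω => (S.Ypot 0 q ω, S.X 0 ω))
    (g := φ) hφ.aestronglyMeasurable hpair.aemeasurable
  rw [hS.map_restrict_eq, integrable_map_measure hφ.aestronglyMeasurable hpair.aemeasurable] at h2
  refine h2.symm.trans ?_
  rw [integrable_withDensity_iff_integrable_smul' (hS.measurable_gps q).ennreal_ofReal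
    (ae_of_all _ fun ω => ENNReal.ofReal_lt_top)]
  refine integrable_congr ?_
  filter_upwards [hS.gps_nonneg] with ω h
  simp [ENNReal.toReal_ofReal h]

/-- Weighting by the propensity score replaces the selection of the units with `D = q`. -/
theorem Sample.Identified.integral_ind (hS : S.Identified P q)
    {φ : ℝ × EuclideanSpace ℝ (Fin p) → ℝ} (hφ : Measurable φ) :
    ∫ ω, S.ind q 0 ω * φ (S.Y 0 ω, S.X 0 ω) ∂P =
      ∫ ω, S.gps P q ω * φ (S.Ypot 0 q ω, S.X 0 ω) ∂P := by
  have hpair : Measurable (fun ω => (S.Ypot 0 q ω, S.X 0 ω)) :=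
    (hS.measurable_Ypot 0 q).prodMk (hS.measurable_X 0)
  have h1 : (fun ω => S.ind q 0 ω * φ (S.Y 0 ω, S.X 0 ω)) =
      {ω | S.D 0 ω = q}.indicator (fun ω => φ (S.Ypot 0 q ω, S.X 0 ω)) := by
    funext ω
    rw [S.ind_mul_Y q (fun y => φ (y, S.X 0 ω)), S.ind_eq_indicator]
    simp [Set.indicator_apply]
  rw [h1, integral_indicator (hS.measurableSet_treated q 0)]
  have h2 := integral_map (μ := P.restrict {ω | S.D 0 ω = q})
    (φ := fun ω => (S.Ypot 0 q ω, S.X 0 ω))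
    (f := φ) hpair.aemeasurable hφ.aestronglyMeasurable
  rw [hS.map_restrict_eq, integral_map hpair.aemeasurable hφ.aestronglyMeasurable] at h2
  rw [← h2, integral_withDensity_eq_integral_toReal_smul (hS.measurable_gps q).ennreal_ofReal
    (ae_of_all _ fun ω => ENNReal.ofReal_lt_top)]
  refine integral_congr_ae ?_
  filter_upwards [hS.gps_nonneg] with ω h
  simp [ENNReal.toReal_ofReal h]

/-- Positivity: a property of the covariates that holds on `D = q` holds almost surely. -/
theorem Sample.Identified.ae_of_ae_treated (hS : S.Identified P q)
    {φ : EuclideanSpace ℝ (Fin p) → ℝ} (hφ : Measurable φ)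
    (h : ∀ᵐ ω ∂P, S.D 0 ω = q → φ (S.X 0 ω) = 0) : ∀ᵐ ω ∂P, φ (S.X 0 ω) = 0 := by
  have hm : Measurable (fun v : ℝ × EuclideanSpace ℝ (Fin p) =>
      {x | φ x ≠ 0}.indicator (fun _ => (1 : ℝ)) v.2) :=
    (measurable_const.indicator (hφ (measurableSet_singleton 0).compl)).comp measurable_snd
  have h0 : ∫ ω, S.ind q 0 ω * {x | φ x ≠ 0}.indicator (fun _ => (1 : ℝ)) (S.X 0 ω) ∂P = 0 := by
    rw [← integral_zero Ω ℝ (μ := P)]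
    refine integral_congr_ae ?_
    filter_upwards [h] with ω hω
    by_cases hD : S.D 0 ω = q
    · simp [hω hD]
    · simp [Sample.ind, hD]
  have hint : Integrable (fun ω => S.gps P q ω *
      {x | φ x ≠ 0}.indicator (fun _ => (1 : ℝ)) (S.X 0 ω)) P := by
    refine (hS.integrable_ind_iff hm).1 ?_
    refine Integrable.of_bound (C := 1) ((hS.measurable_ind q 0).mul
      (hm.comp ((hS.measurable_Y 0).prodMk (hS.measurable_X 0)))).aestronglyMeasurable
      (ae_of_all _ fun ω => ?_)
    simp only [Set.indicator_apply]
    split_ifs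
    · simpa using S.abs_ind_le q 0 ω
    · simp
  rw [hS.integral_ind hm, integral_eq_zero_iff_of_nonneg_ae ?_ hint] at h0
  · filter_upwards [h0, hS.positivity] with ω h1 h2
    by_contra hne
    simp [hne] at h1
    exact h2.ne' h1
  · filter_upwards [hS.gps_nonneg] with ω hω
    exact mul_nonneg hω (Set.indicator_nonneg (fun _ _ => zero_le_one) _)

/-! #### Inverse probability weighting -/

variable {M : PSModel p Q} {α : M.Θ}

theorem Sample.Identified.integrable_ipw_iff (hS : S.Identified P q) (hα : M.IsTrueValue S P α)
    {φ : ℝ × EuclideanSpace ℝ (Fin p) → ℝ} (hφ : Measurable φ) :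
    Integrable (fun ω => S.ind q 0 ω * (φ (S.Y 0 ω, S.X 0 ω) / M.prob (S.X 0 ω) q α)) P ↔
      Integrable (fun ω => φ (S.Ypot 0 q ω, S.X 0 ω)) P := by
  have h := hS.integrable_ind_iff (φ := fun v => φ v / M.prob v.2 q α)
    (hφ.div ((M.measurable q α).comp measurable_snd))
  refine h.trans (integrable_congr ?_)
  filter_upwards [hS.positivity, hα q] with ω h1 h2
  rw [h2]; field_simp

theorem Sample.Identified.integral_ipw (hS : S.Identified P q) (hα : M.IsTrueValue S P α)
    {φ : ℝ × EuclideanSpace ℝ (Fin p) → ℝ} (hφ : Measurable φ) :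
    ∫ ω, S.ind q 0 ω * (φ (S.Y 0 ω, S.X 0 ω) / M.prob (S.X 0 ω) q α) ∂P =
      ∫ ω, φ (S.Ypot 0 q ω, S.X 0 ω) ∂P := by
  have h := hS.integral_ind (φ := fun v => φ v / M.prob v.2 q α)
    (hφ.div ((M.measurable q α).comp measurable_snd))
  refine h.trans (integral_congr_ae ?_)
  filter_upwards [hS.positivity, hα q] with ω h1 h2
  rw [h2]; field_simp

/-! #### Outcome regression -/

variable {A : ORModel p Q} {β : A.Θ}

/-- The residual of a correct outcome regression is orthogonal to the functions of `(X, D)`. -/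
theorem Sample.Identified.integral_residual (hS : S.Identified P q) (hβ : A.IsTrueValue S P β)
    {ψ : EuclideanSpace ℝ (Fin p) → ℝ} (hψ : Measurable ψ)
    (hint : Integrable (fun ω => S.ind q 0 ω * ψ (S.X 0 ω) *
      (S.Y 0 ω - A.mean (S.X 0 ω) q β)) P) :
    ∫ ω, S.ind q 0 ω * ψ (S.X 0 ω) * (S.Y 0 ω - A.mean (S.X 0 ω) q β) ∂P = 0 := by
  have hXD : Measurable (fun ω => (S.X 0 ω, S.D 0 ω)) :=
    (hS.measurable_X 0).prodMk (hS.measurable_D 0)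
  have hmle : S.treatmentSigma ≤ ‹MeasurableSpace Ω› := hXD.comap_le
  have hXDm : Measurable[S.treatmentSigma] (fun ω => (S.X 0 ω, S.D 0 ω)) := comap_measurable _
  set W : Ω → ℝ := fun ω => S.ind q 0 ω * ψ (S.X 0 ω) with hW
  have hWm : StronglyMeasurable[S.treatmentSigma] W := by
    have : Measurable (fun v : EuclideanSpace ℝ (Fin p) × Fin Q =>
        (if v.2 = q then (1 : ℝ) else 0) * ψ v.1) :=
      (Measurable.ite (measurable_snd (measurableSet_singleton q)) measurable_const
        measurable_const).mul (hψ.comp measurable_fst)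
    exact (this.comp hXDm).stronglyMeasurable
  set R : Ω → ℝ := S.Y 0 - fun ω => A.mean (S.X 0 ω) (S.D 0 ω) β with hR
  have hAi : Integrable (fun ω => A.mean (S.X 0 ω) (S.D 0 ω) β) P :=
    (integrable_congr hβ).2 integrable_condExp
  have hAm : StronglyMeasurable[S.treatmentSigma] (fun ω => A.mean (S.X 0 ω) (S.D 0 ω) β) := by
    have : Measurable (fun v : EuclideanSpace ℝ (Fin p) × Fin Q => A.mean v.1 v.2 β) :=
      measurable_from_prod_countable_left fun d => A.measurable d β
    exact (this.comp hXDm).stronglyMeasurable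
  have hRi : Integrable R P := hS.integrable_Y.sub hAi
  have hR0 : P[R | S.treatmentSigma] =ᵐ[P] 0 := by
    have h1 := condExp_sub hS.integrable_Y hAi S.treatmentSigma
    rw [condExp_of_stronglyMeasurable hmle hAm hAi] at h1
    filter_upwards [h1, hβ] with ω h2 h3
    rw [h2, Pi.sub_apply, h3]
    exact sub_self _
  have heq : (fun ω => S.ind q 0 ω * ψ (S.X 0 ω) * (S.Y 0 ω - A.mean (S.X 0 ω) q β)) = W * R := by
    funext ω
    simp only [hW, hR, Pi.mul_apply, Pi.sub_apply, Sample.ind]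
    split_ifs with h
    · rw [h]
    · simp
  rw [heq] at hint ⊢
  have hpull : P[W * R | S.treatmentSigma] =ᵐ[P] W * P[R | S.treatmentSigma] :=
    condExp_mul_of_stronglyMeasurable_left hWm hint hRi
  rw [← integral_condExp hmle]
  rw [← integral_zero Ω ℝ (μ := P)]
  refine integral_congr_ae ?_
  filter_upwards [hpull, hR0] with ω h1 h2
  rw [h1, Pi.mul_apply, h2]; simp

/-- The outcome regression formula: averaging a correct model at `D = q` over the covariates gives
the mean potential outcome. -/
theorem Sample.Identified.integral_mean_eq_apo (hS : S.Identified P q)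
    (hβ : A.IsTrueValue S P β) (hi : Integrable (fun ω => A.mean (S.X 0 ω) q β) P) :
    ∫ ω, A.mean (S.X 0 ω) q β ∂P = S.apo P q := by
  have hmle : S.covariateSigma ≤ ‹MeasurableSpace Ω› := (hS.measurable_X 0).comap_le
  set R : Ω → ℝ := fun ω => S.Ypot 0 q ω - A.mean (S.X 0 ω) q β with hR
  have hRi : Integrable R P := (hS.integrable q).sub hi
  have hgRi : Integrable (S.gps P q * R) P := by
    refine hRi.bdd_mul (c := 1) (hS.measurable_gps q).aestronglyMeasurable ?_
    filter_upwards [hS.gps_nonneg, hS.gps_le_one] with ω h1 h2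
    rwa [Real.norm_of_nonneg h1]
  have hset : ∀ s, MeasurableSet[S.covariateSigma] s → ∫ ω in s, (S.gps P q * R) ω ∂P = 0 := by
    rintro _ ⟨t, ht, rfl⟩
    have hψ : Measurable (t.indicator (fun _ => (1 : ℝ))) := measurable_const.indicator ht
    have hφ : Measurable (fun v : ℝ × EuclideanSpace ℝ (Fin p) =>
        t.indicator (fun _ => (1 : ℝ)) v.2 * (v.1 - A.mean v.2 q β)) :=
      (hψ.comp measurable_snd).mul (measurable_fst.sub ((A.measurable q β).comp measurable_snd))
    have hgi : Integrable (fun ω => S.gps P q ω * (t.indicator (fun _ => (1 : ℝ)) (S.X 0 ω) *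
        (S.Ypot 0 q ω - A.mean (S.X 0 ω) q β))) P := by
      have h1 := hgRi.indicator (hS.measurable_X 0 ht)
      refine h1.congr (ae_of_all _ fun ω => ?_)
      by_cases h : S.X 0 ω ∈ t <;> simp [hR, h]
    have h2 := (hS.integrable_ind_iff hφ).2 hgi
    have h3 := hS.integral_ind hφ
    have h4 := hS.integral_residual hβ hψ (h2.congr (ae_of_all _ fun ω => (mul_assoc _ _ _).symm))
    rw [← integral_indicator (hS.measurable_X 0 ht)]
    calc ∫ ω, (S.X 0 ⁻¹' t).indicator (S.gps P q * R) ω ∂P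
        = ∫ ω, S.gps P q ω * (t.indicator (fun _ => (1 : ℝ)) (S.X 0 ω) *
            (S.Ypot 0 q ω - A.mean (S.X 0 ω) q β)) ∂P := by
          refine integral_congr_ae (ae_of_all _ fun ω => ?_)
          by_cases h : S.X 0 ω ∈ t <;> simp [hR, h]
      _ = ∫ ω, S.ind q 0 ω * t.indicator (fun _ => (1 : ℝ)) (S.X 0 ω) *
            (S.Y 0 ω - A.mean (S.X 0 ω) q β) ∂P := by
          rw [← h3]
          exact integral_congr_ae (ae_of_all _ fun ω => (mul_assoc _ _ _).symm)
      _ = 0 := h4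
  have h0 : (0 : Ω → ℝ) =ᵐ[P] P[S.gps P q * R | S.covariateSigma] := by
    refine ae_eq_condExp_of_forall_setIntegral_eq hmle hgRi (fun s _ _ => integrableOn_zero)
      (fun s hs _ => ?_) aestronglyMeasurable_zero
    rw [hset s hs]; simp
  have hpull : P[S.gps P q * R | S.covariateSigma] =ᵐ[P] S.gps P q * P[R | S.covariateSigma] :=
    condExp_mul_of_stronglyMeasurable_left (S.gps_stronglyMeasurable P q) hgRi hRi
  have hR0 : P[R | S.covariateSigma] =ᵐ[P] 0 := by
    filter_upwards [h0, hpull, hS.positivity] with ω h1 h2 h3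
    rw [h2] at h1
    rcases mul_eq_zero.1 h1.symm with h | h
    · exact absurd h h3.ne'
    · exact h
  have hRint : ∫ ω, R ω ∂P = 0 := by
    rw [← integral_condExp hmle, integral_congr_ae hR0]; simp
  rw [hR, integral_sub (hS.integrable q) hi] at hRint
  rw [Sample.apo]
  linarith

end Identification

/-! ### Empirical likelihood for a finite sample -/

section EmpiricalLikelihood

variable {J K : ℕ} {M : Finset ℕ} {h : ℕ → Vec J K}

theorem IsRoot.sum_dotProduct_eq_zero {l : Vec J K} (hl : IsRoot M h l) (v : Vec J K) :
    ∑ i ∈ M, (1 / (1 + l ⬝ᵥ h i)) * (v ⬝ᵥ h i) = 0 := by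
  have := congrArg (fun w => v ⬝ᵥ w) hl.2
  simpa [dotProduct_sum, dotProduct_smul] using this

/-- A root with positive denominators solves the empirical likelihood problem: with
`u i = w i (1 + lᵀ h i)`, which sum to one for every feasible `w`, the ratio of the two products is
`∏ (m u i) ≤ ∏ exp (m u i - 1) = 1`. -/
theorem IsRoot.isELMultiplier {l : Vec J K} (hM : M.Nonempty) (hl : IsRoot M h l)
    (hpos : ∀ i ∈ M, 0 < 1 + l ⬝ᵥ h i) : IsELMultiplier M h l := by
  have hm : (0 : ℝ) < M.card := by exact_mod_cast hM.card_pos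
  refine ⟨hl, ⟨fun i hi => ?_, ?_, ?_⟩, fun w hw => ?_⟩
  · have := hpos i hi
    positivity
  · have h1 := hl.sum_dotProduct_eq_zero l
    have h2 : ∀ i ∈ M, 1 / (M.card : ℝ) * (1 / (1 + l ⬝ᵥ h i)) =
        1 / (M.card : ℝ) - 1 / (M.card : ℝ) * ((1 / (1 + l ⬝ᵥ h i)) * (l ⬝ᵥ h i)) := by
      intro i hi
      have := (hpos i hi).ne'
      field_simp
      ring
    rw [Finset.sum_congr rfl h2, Finset.sum_sub_distrib, ← Finset.mul_sum, h1]
    simp [hm.ne']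
  · simp only [mul_smul]
    rw [← Finset.smul_sum, hl.2, smul_zero]
  · obtain ⟨hw0, hw1, hw2⟩ := hw
    have hs : ∑ i ∈ M, w i * (1 + l ⬝ᵥ h i) = 1 := by
      have h3 := congrArg (fun v => l ⬝ᵥ v) hw2
      simp only [dotProduct_sum, dotProduct_smul, smul_eq_mul, dotProduct_zero] at h3
      simp only [mul_add, mul_one, Finset.sum_add_distrib, hw1, h3, add_zero]
    have h4 : ∏ i ∈ M, (M.card * (w i * (1 + l ⬝ᵥ h i))) ≤ 1 := by
      calc ∏ i ∈ M, (M.card * (w i * (1 + l ⬝ᵥ h i)))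
          ≤ ∏ i ∈ M, Real.exp (M.card * (w i * (1 + l ⬝ᵥ h i)) - 1) := by
            refine Finset.prod_le_prod (fun i hi => ?_) fun i _ => ?_
            · have := hpos i hi
              have := hw0 i hi
              positivity
            · linarith [Real.add_one_le_exp (M.card * (w i * (1 + l ⬝ᵥ h i)) - 1)]
        _ = 1 := by
            rw [← Real.exp_sum, Finset.sum_sub_distrib, ← Finset.mul_sum, hs]
            simp
    calc ∏ i ∈ M, w i = (∏ i ∈ M, (M.card * (w i * (1 + l ⬝ᵥ h i)))) *
          ∏ i ∈ M, (1 / (M.card : ℝ) * (1 / (1 + l ⬝ᵥ h i))) := by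
          rw [← Finset.prod_mul_distrib]
          refine Finset.prod_congr rfl fun i hi => ?_
          have := (hpos i hi).ne'
          field_simp
      _ ≤ 1 * ∏ i ∈ M, (1 / (M.card : ℝ) * (1 / (1 + l ⬝ᵥ h i))) := by
          refine mul_le_mul_of_nonneg_right h4 (Finset.prod_nonneg fun i hi => ?_)
          have := hpos i hi
          positivity
      _ = _ := one_mul _

theorem IsELMultiplier.pos {l : Vec J K} (hl : IsELMultiplier M h l) {i : ℕ} (hi : i ∈ M) :
    0 < 1 + l ⬝ᵥ h i := by
  have hm : (0 : ℝ) < M.card := by exact_mod_cast Finset.card_pos.2 ⟨i, hi⟩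
  refine lt_of_le_of_ne ?_ (hl.1.1 i hi).symm
  have h1 := hl.2.1.1 i hi
  beta_reduce at h1
  rw [← div_eq_mul_one_div, div_nonneg_iff] at h1
  rcases h1 with h1 | h1
  · exact h1.2
  · exact absurd h1.1 (not_le.2 (by positivity))

/-- Roots with positive denominators need not be unique, but their denominators are. -/
theorem IsRoot.dotProduct_eq {l l' : Vec J K} (hl : IsRoot M h l) (hl' : IsRoot M h l')
    (hpos : ∀ i ∈ M, 0 < 1 + l ⬝ᵥ h i) (hpos' : ∀ i ∈ M, 0 < 1 + l' ⬝ᵥ h i) {i : ℕ} (hi : i ∈ M) :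
    l ⬝ᵥ h i = l' ⬝ᵥ h i := by
  have h1 : ∑ i ∈ M, (l ⬝ᵥ h i - l' ⬝ᵥ h i) ^ 2 / ((1 + l ⬝ᵥ h i) * (1 + l' ⬝ᵥ h i)) = 0 := by
    have ha := hl.sum_dotProduct_eq_zero (l - l')
    have hb := hl'.sum_dotProduct_eq_zero (l - l')
    rw [← sub_eq_zero.2 (hb.trans ha.symm), ← Finset.sum_sub_distrib]
    refine Finset.sum_congr rfl fun i hi => ?_
    have := (hpos i hi).ne'
    have := (hpos' i hi).ne'
    rw [sub_dotProduct]
    field_simp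
    ring
  have h2 := (Finset.sum_eq_zero_iff_of_nonneg fun i hi => by
    have := hpos i hi
    have := hpos' i hi
    positivity).1 h1 i hi
  have := hpos i hi
  have := hpos' i hi
  rcases div_eq_zero_iff.1 h2 with h3 | h3
  · exact sub_eq_zero.1 (pow_eq_zero_iff two_ne_zero |>.1 h3)
  · exact absurd h3 (by positivity)

theorem log_one_add_le {x : ℝ} (hx : |x| ≤ 1 / 4) : Real.log (1 + x) ≤ x - x ^ 2 / 6 := by
  have h1 := Real.abs_log_sub_add_sum_range_le (x := -x) (by rw [abs_neg]; linarith) 2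
  simp only [Finset.sum_range_succ, Finset.sum_range_zero, abs_neg, sub_neg_eq_add] at h1
  have h2 : |x| ^ (2 + 1) / (1 - |x|) ≤ x ^ 2 / 3 := by
    rw [div_le_iff₀ (by linarith), ← sq_abs x]
    nlinarith [sq_nonneg |x|, abs_nonneg x]
  have h3 := (abs_le.1 (h1.trans h2)).2
  norm_num at h3
  linarith

/-- Existence of a small root.  On the compact set of `v ∈ V` with `‖v‖ ≤ r` the concave function
`∑ log (1 + vᵀ h i)` has a maximiser; it is an interior point of the ball, because on the sphere the
quadratic term (at least `c r² / 6`) exceeds the linear one (at most `A r`), and its gradient, an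
element of `V`, vanishes there. -/
theorem exists_isRoot {V : Submodule ℝ (Vec J K)} {c A R r : ℝ} (hr : 0 < r)
    (hV : ∀ i ∈ M, h i ∈ V) (hc : ∀ v ∈ V, c * ‖v‖ ^ 2 ≤ ∑ i ∈ M, (v ⬝ᵥ h i) ^ 2)
    (hA : ∀ v ∈ V, ∑ i ∈ M, v ⬝ᵥ h i ≤ A * ‖v‖) (hR : ∀ i ∈ M, ∀ v, |v ⬝ᵥ h i| ≤ R * ‖v‖)
    (hR0 : 0 ≤ R) (hAr : A < c * r / 6) (hrR : R * r ≤ 1 / 4) :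
    ∃ l : Vec J K, ‖l‖ ≤ r ∧ IsRoot M h l := by
  have hsmall : ∀ v, ‖v‖ ≤ r → ∀ i ∈ M, |v ⬝ᵥ h i| ≤ 1 / 4 := fun v hv i hi =>
    (hR i hi v).trans ((mul_le_mul_of_nonneg_left hv hR0).trans hrR)
  have hpos : ∀ v, ‖v‖ ≤ r → ∀ i ∈ M, 0 < 1 + v ⬝ᵥ h i := fun v hv i hi => by
    linarith [(abs_le.1 (hsmall v hv i hi)).1]
  set C : Set (Vec J K) := (V : Set (Vec J K)) ∩ Metric.closedBall 0 r with hC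
  have hCc : IsCompact C := (isCompact_closedBall 0 r).inter_left V.closed_of_finiteDimensional
  have h0 : (0 : Vec J K) ∈ C := ⟨V.zero_mem, by simp [hr.le]⟩
  set F : Vec J K → ℝ := fun v => ∑ i ∈ M, Real.log (1 + v ⬝ᵥ h i) with hF
  have hdot : ∀ i, Continuous fun v : Vec J K => v ⬝ᵥ h i := fun i =>
    Continuous.dotProduct continuous_id continuous_const
  have hFc : ContinuousOn F C := by
    refine continuousOn_finsetSum _ fun i hi => ?_
    refine ContinuousOn.log (continuous_const.add (hdot i)).continuousOn fun v hv => ?_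
    exact (hpos v (by simpa using hv.2) i hi).ne'
  obtain ⟨l, hlC, hlmax⟩ := hCc.exists_isMaxOn ⟨0, h0⟩ hFc
  have hlr : ‖l‖ ≤ r := by simpa using hlC.2
  have hl0 : 0 ≤ F l := by
    have := hlmax h0
    simpa [hF] using this
  have hlt : ‖l‖ < r := by
    refine lt_of_le_of_ne hlr fun heq => ?_
    have h1 : F l ≤ A * ‖l‖ - c * ‖l‖ ^ 2 / 6 := by
      calc F l ≤ ∑ i ∈ M, (l ⬝ᵥ h i - (l ⬝ᵥ h i) ^ 2 / 6) :=
            Finset.sum_le_sum fun i hi => log_one_add_le (hsmall l hlr i hi)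
        _ = ∑ i ∈ M, l ⬝ᵥ h i - (∑ i ∈ M, (l ⬝ᵥ h i) ^ 2) / 6 := by
            rw [Finset.sum_sub_distrib, Finset.sum_div]
        _ ≤ _ := by linarith [hA l hlC.1, hc l hlC.1]
    rw [heq] at h1
    have h2 : A * r - c * r ^ 2 / 6 = r * (A - c * r / 6) := by ring
    rw [h2] at h1
    nlinarith
  have hne : ∀ i ∈ M, 1 + l ⬝ᵥ h i ≠ 0 := fun i hi => (hpos l hlr i hi).ne'
  refine ⟨l, hlr, hne, ?_⟩
  set s : Vec J K := ∑ i ∈ M, (1 / (1 + l ⬝ᵥ h i)) • h i with hs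
  have hsV : s ∈ V := V.sum_mem fun i hi => V.smul_mem _ (hV i hi)
  have hder : HasDerivAt (fun t : ℝ => F (l + t • s)) (s ⬝ᵥ s) 0 := by
    have h1 : ∀ i ∈ M, HasDerivAt (fun t : ℝ => Real.log (1 + (l + t • s) ⬝ᵥ h i))
        ((s ⬝ᵥ h i) / (1 + l ⬝ᵥ h i)) 0 := by
      intro i hi
      have h2 : HasDerivAt (fun t : ℝ => 1 + (l + t • s) ⬝ᵥ h i) (s ⬝ᵥ h i) 0 := by
        have h3 : (fun t : ℝ => 1 + (l + t • s) ⬝ᵥ h i) =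
            fun t : ℝ => (1 + l ⬝ᵥ h i) + t * (s ⬝ᵥ h i) := by
          funext t
          rw [add_dotProduct, smul_dotProduct, smul_eq_mul]; ring
        rw [h3]
        simpa using ((hasDerivAt_id (0 : ℝ)).mul_const (s ⬝ᵥ h i)).const_add (1 + l ⬝ᵥ h i)
      have h4 := h2.log (by simpa using hne i hi)
      simpa using h4
    have h5 := HasDerivAt.fun_sum h1
    have h6 : ∑ i ∈ M, (s ⬝ᵥ h i) / (1 + l ⬝ᵥ h i) = s ⬝ᵥ s := by
      conv_rhs => rw [hs, dotProduct_sum]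
      refine Finset.sum_congr rfl fun i _ => ?_
      rw [dotProduct_smul, smul_eq_mul, one_div, div_eq_inv_mul]
    rw [← h6]
    exact h5
  have hloc : IsLocalMax (fun t : ℝ => F (l + t • s)) 0 := by
    have hcont : Tendsto (fun t : ℝ => ‖l + t • s‖) (𝓝 0) (𝓝 ‖l‖) := by
      have : Continuous fun t : ℝ => ‖l + t • s‖ := by fun_prop
      simpa using this.tendsto 0
    filter_upwards [hcont.eventually_lt_const hlt] with t ht
    have hmem : l + t • s ∈ C :=
      ⟨V.add_mem hlC.1 (V.smul_mem _ hsV), by simpa using ht.le⟩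
    simpa using hlmax hmem
  exact dotProduct_self_eq_zero.1 (hloc.hasDerivAt_eq_zero hder)

end EmpiricalLikelihood

/-! ### Sample means over a treatment arm -/

section Means

variable {Ω : Type*} {p Q J K : ℕ} {PS : Fin J → PSModel p Q} {OR : Fin K → ORModel p Q}
  {q : Fin Q} {S : Sample Ω p Q}

theorem measurable_modelVec (γ : Params PS OR) (l : Fin J ⊕ Fin K) :
    Measurable (fun x => modelVec PS OR q γ x l) := by
  cases l with
  | inl j => exact (PS j).measurable q (γ.1 j)
  | inr k => exact (OR k).measurable q (γ.2 k)

theorem continuous_modelVec (x : EuclideanSpace ℝ (Fin p)) :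
    Continuous (fun γ : Params PS OR => modelVec PS OR q γ x) := by
  refine continuous_pi fun l => ?_
  cases l with
  | inl j => exact ((PS j).continuous x q).comp ((continuous_apply j).comp continuous_fst)
  | inr k => exact ((OR k).continuous x q).comp ((continuous_apply k).comp continuous_snd)

theorem continuous_prob (j : Fin J) (x : EuclideanSpace ℝ (Fin p)) :
    Continuous (fun γ : Params PS OR => (PS j).prob x q (γ.1 j)) :=
  ((PS j).continuous x q).comp ((continuous_apply j).comp continuous_fst)

theorem centreHat_apply (γ : Params PS OR) (n : ℕ) (ω : Ω) (l : Fin J ⊕ Fin K) :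
    centreHat PS OR q S γ n ω l =
      (∑ i ∈ Finset.range n, modelVec PS OR q γ (S.X i ω) l) / n := by
  simp only [centreHat, Pi.smul_apply, Finset.sum_apply, smul_eq_mul]
  rw [one_div, inv_mul_eq_div]

theorem muMR_eq_div (γ : Params PS OR) (ρ : Vec J K) (n : ℕ) (ω : Ω) :
    muMR PS OR q S γ ρ n ω =
      (∑ i ∈ S.arm q n ω, S.Y i ω / (1 + ρ ⬝ᵥ gHat PS OR q S γ n ω i)) /
        ∑ i ∈ S.arm q n ω, 1 / (1 + ρ ⬝ᵥ gHat PS OR q S γ n ω i) := by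
  rcases (S.arm q n ω).eq_empty_or_nonempty with h | h
  · simp [muMR, h]
  · have hm : ((S.arm q n ω).card : ℝ) ≠ 0 := by exact_mod_cast h.card_pos.ne'
    rw [muMR, Finset.sum_div]
    refine Finset.sum_congr rfl fun i _ => ?_
    rw [weight, mul_div_mul_left _ _ (by positivity)]
    ring

/-- At a root the weighted mean of the `k`-th outcome regression equals its unweighted mean, so the
estimator is this unweighted mean plus a weighted mean of residuals. -/
theorem IsRoot.muMR_eq {γ : Params PS OR} {ρ : Vec J K} {n : ℕ} {ω : Ω}
    (h : IsRoot (S.arm q n ω) (gHat PS OR q S γ n ω) ρ) (k : Fin K)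
    (hne : ∑ i ∈ S.arm q n ω, 1 / (1 + ρ ⬝ᵥ gHat PS OR q S γ n ω i) ≠ 0) :
    muMR PS OR q S γ ρ n ω =
      (∑ i ∈ S.arm q n ω, (S.Y i ω - (OR k).mean (S.X i ω) q (γ.2 k)) /
        (1 + ρ ⬝ᵥ gHat PS OR q S γ n ω i)) /
        (∑ i ∈ S.arm q n ω, 1 / (1 + ρ ⬝ᵥ gHat PS OR q S γ n ω i)) +
      centreHat PS OR q S γ n ω (Sum.inr k) := by
  have h1 := congrFun h.2 (Sum.inr k)
  simp only [Finset.sum_apply, Pi.smul_apply, smul_eq_mul, Pi.zero_apply] at h1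
  rw [muMR_eq_div, div_add' _ _ _ hne]
  congr 1
  rw [Finset.mul_sum, ← Finset.sum_add_distrib, ← sub_eq_zero, ← Finset.sum_sub_distrib, ← h1]
  refine Finset.sum_congr rfl fun i _ => ?_
  simp only [gHat, Pi.sub_apply, modelVec, Sum.elim_inr]
  ring

theorem mem_arm {n i : ℕ} {ω : Ω} : i ∈ S.arm q n ω ↔ i < n ∧ S.D i ω = q := by
  simp [Sample.arm]

variable [MeasurableSpace Ω] [StandardBorelSpace Ω] {P : Measure Ω} [IsProbabilityMeasure P]

theorem Sample.Identified.integral_obsLaw (hS : S.Identified P q)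
    {φ : EuclideanSpace ℝ (Fin p) × Fin Q × ℝ → ℝ} (hφ : Measurable φ) :
    ∫ z, φ z ∂(S.obsLaw P) = ∫ ω, φ (S.obs 0 ω) ∂P :=
  integral_map (hS.measurable_obs 0).aemeasurable hφ.aestronglyMeasurable

theorem Sample.Identified.ae_of_ae_obsLaw (hS : S.Identified P q)
    {r : EuclideanSpace ℝ (Fin p) × Fin Q × ℝ → Prop} (h : ∀ᵐ z ∂(S.obsLaw P), r z) :
    ∀ᵐ ω ∂P, r (S.obs 0 ω) := ae_of_ae_map (hS.measurable_obs 0).aemeasurable h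

theorem Sample.Identified.integrable_of_dominated (hS : S.Identified P q)
    {B : EuclideanSpace ℝ (Fin p) × Fin Q × ℝ → ℝ} (hB : Integrable B (S.obsLaw P))
    {ψ : Ω → ℝ} (hψ : AEStronglyMeasurable ψ P) (h : ∀ᵐ ω ∂P, |ψ ω| ≤ |B (S.obs 0 ω)|) :
    Integrable ψ P :=
  (hB.comp_measurable (hS.measurable_obs 0)).mono hψ h

/-- The uniform law of large numbers for sums over the treatment arm, normalised by `n`. -/
theorem Sample.Identified.tendsto_arm_mean (hS : S.Identified P q) {T : Type*}
    [PseudoMetricSpace T] [TopologicalSpace.SeparableSpace T]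
    {φ : T → EuclideanSpace ℝ (Fin p) × Fin Q × ℝ → ℝ} (hm : ∀ u, Measurable (φ u)) {u₀ : T}
    {U : Set T} (hU : U ∈ 𝓝 u₀) {B : EuclideanSpace ℝ (Fin p) × Fin Q × ℝ → ℝ}
    (hB : Integrable B (S.obsLaw P))
    (hdom : ∀ᵐ z ∂(S.obsLaw P), z.2.1 = q → ∀ u ∈ U, |φ u z| ≤ B z)
    (hcont : ∀ᵐ z ∂(S.obsLaw P), z.2.1 = q → ContinuousOn (fun u => φ u z) U)
    {u : ℕ × Ω → T} (hu : Tendsto u (inProb P) (𝓝 u₀)) :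
    Tendsto (fun x : ℕ × Ω => (∑ i ∈ S.arm q x.1 x.2, φ (u x) (S.obs i x.2)) / x.1) (inProb P)
      (𝓝 (∫ ω, S.ind q 0 ω * φ u₀ (S.obs 0 ω) ∂P)) := by
  have hmeas : ∀ v, Measurable fun z : EuclideanSpace ℝ (Fin p) × Fin Q × ℝ =>
      if z.2.1 = q then φ v z else 0 := fun v =>
    Measurable.ite (measurable_snd.fst (measurableSet_singleton q)) (hm v) measurable_const
  have h := hS.isIID_obs.uniform_law_large_numbers
    (φ := fun v z => if z.2.1 = q then φ v z else 0) hmeas hU hB.abs ?_ ?_ hu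
  · convert h using 2
    · rw [Sample.arm, Finset.sum_filter]
      rfl
    · have h1 := hS.integral_obsLaw (hmeas u₀)
      rw [Sample.obsLaw] at h1
      rw [h1]
      refine integral_congr_ae (ae_of_all _ fun ω => ?_)
      change (if S.D 0 ω = q then (1 : ℝ) else 0) * _ = if S.D 0 ω = q then _ else _
      split_ifs <;> simp
  · filter_upwards [hdom] with z hz v hv
    split_ifs with hq
    · exact (hz hq v hv).trans (le_abs_self _)
    · simp
  · filter_upwards [hcont] with z hz
    by_cases hq : z.2.1 = q
    · simpa [hq] using hz hq
    · simpa [hq] using continuousOn_const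

theorem Sample.Identified.tendsto_centreHat (hS : S.Identified P q) {γ : Params PS OR}
    (hdom : ∃ U ∈ 𝓝 γ, ∃ B : EuclideanSpace ℝ (Fin p) × Fin Q × ℝ → ℝ,
      Integrable B (S.obsLaw P) ∧
      ∀ᵐ z ∂(S.obsLaw P), ∀ γ' ∈ U, ∀ l, |modelVec PS OR q γ' z.1 l| ≤ B z)
    {γhat : ℕ × Ω → Params PS OR} (hγ : Tendsto γhat (inProb P) (𝓝 γ)) :
    Tendsto (fun x : ℕ × Ω => centreHat PS OR q S (γhat x) x.1 x.2) (inProb P)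
      (𝓝 (centre PS OR q S P γ)) := by
  obtain ⟨U, hU, B, hB, hBd⟩ := hdom
  rw [tendsto_pi_nhds]
  intro l
  have hm : ∀ γ' : Params PS OR, Measurable fun z : EuclideanSpace ℝ (Fin p) × Fin Q × ℝ =>
      modelVec PS OR q γ' z.1 l := fun γ' => (measurable_modelVec γ' l).comp measurable_fst
  have h := hS.isIID_obs.uniform_law_large_numbers hm hU hB
    (by filter_upwards [hBd] with z hz γ' hγ' using hz γ' hγ' l)
    (ae_of_all _ fun z => ((continuous_apply l).comp (continuous_modelVec z.1)).continuousOn) hγ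
  have h1 := hS.integral_obsLaw (hm γ)
  rw [Sample.obsLaw] at h1
  rw [h1] at h
  refine h.congr fun x => ?_
  rw [centreHat_apply]
  rfl

end Means

/-! ### Robustness to the outcome regression models -/

section OutcomeRegression

variable {Ω : Type*} [MeasurableSpace Ω] [StandardBorelSpace Ω] {P : Measure Ω}
  [IsProbabilityMeasure P] {p Q J K : ℕ} {PS : Fin J → PSModel p Q} {OR : Fin K → ORModel p Q}
  {q : Fin Q} {S : Sample Ω p Q}

/-- Consistency at a correct outcome regression model. -/
theorem tendsto_muMR_of_outcomeReg (hS : S.Identified P q) {γhat : ℕ × Ω → Params PS OR}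
    {γ : Params PS OR} (hγ : Tendsto γhat (inProb P) (𝓝 γ)) {k : Fin K}
    (hk : (OR k).IsTrueValue S P (γ.2 k)) {rho : ℕ × Ω → Vec J K} {ρ : Vec J K}
    (hroot : ∀ᶠ x in inProb P, IsRoot (S.arm q x.1 x.2) (gHat PS OR q S (γhat x) x.1 x.2) (rho x))
    (hrho : Tendsto rho (inProb P) (𝓝 ρ)) (hreg : RegularOR PS OR q S P k γ ρ) :
    Tendsto (fun x => muMR PS OR q S (γhat x) (rho x) x.1 x.2) (inProb P) (𝓝 (S.apo P q)) := by
  set c := centre PS OR q S P γ with hc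
  have hcentre := hS.tendsto_centreHat hreg.dominated_models hγ
  -- the limit of the unweighted mean of the correct model
  have hck : c (Sum.inr k) = S.apo P q := by
    refine hS.integral_mean_eq_apo hk ?_
    obtain ⟨U, hU, B, hB, hBd⟩ := hreg.dominated_models
    refine hS.integrable_of_dominated hB
      (((OR k).measurable q (γ.2 k)).comp (hS.measurable_X 0)).aestronglyMeasurable ?_
    filter_upwards [hS.ae_of_ae_obsLaw hBd] with ω hω
    exact (hω γ (mem_of_mem_nhds hU) (Sum.inr k)).trans (le_abs_self _)
  obtain ⟨U, hU, B, hB, hBd⟩ := hreg.dominated_weights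
  set u : ℕ × Ω → Params PS OR × Vec J K × Vec J K := fun x =>
    (γhat x, centreHat PS OR q S (γhat x) x.1 x.2, rho x) with hu
  have hulim : Tendsto u (inProb P) (𝓝 (γ, c, ρ)) := hγ.prodMk_nhds (hcentre.prodMk_nhds hrho)
  set den : Params PS OR × Vec J K × Vec J K → EuclideanSpace ℝ (Fin p) → ℝ := fun v x =>
    1 + v.2.2 ⬝ᵥ (modelVec PS OR q v.1 x - v.2.1) with hden
  have hdenm : ∀ v, Measurable (den v) := fun v => by
    refine measurable_const.add (Finset.measurable_fun_sum _ fun l _ => ?_)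
    exact measurable_const.mul ((measurable_modelVec v.1 l).sub measurable_const)
  have hdenc : ∀ x, Continuous fun v => den v x := fun x => by
    refine continuous_const.add (Continuous.dotProduct continuous_snd.snd ?_)
    exact ((continuous_modelVec x).comp continuous_fst).sub continuous_snd.fst
  -- on `D = q` the denominators do not vanish near the limit
  have hpos : ∀ᵐ z ∂(S.obsLaw P), z.2.1 = q → ∀ v ∈ U, 0 < |den v z.1| := by
    filter_upwards [hBd] with z hz hq v hv
    have h1 := hz hq v hv
    refine (abs_nonneg _).lt_of_ne fun h0 => ?_
    have h0' : |1 + v.2.2 ⬝ᵥ (modelVec PS OR q v.1 z.1 - v.2.1)| = 0 := h0.symm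
    rw [h0', mul_zero] at h1
    linarith [abs_nonneg (z.2.2 - (OR k).mean z.1 q (v.1.2 k))]
  have hres_m : ∀ v : Params PS OR × Vec J K × Vec J K, Measurable
      fun z : EuclideanSpace ℝ (Fin p) × Fin Q × ℝ =>
        (z.2.2 - (OR k).mean z.1 q (v.1.2 k)) / den v z.1 := fun v =>
    (measurable_snd.snd.sub (((OR k).measurable q _).comp measurable_fst)).div
      ((hdenm v).comp measurable_fst)
  have hres_dom : ∀ᵐ z ∂(S.obsLaw P), z.2.1 = q → ∀ v ∈ U,
      |(z.2.2 - (OR k).mean z.1 q (v.1.2 k)) / den v z.1| ≤ B z := by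
    filter_upwards [hBd, hpos] with z hz hp hq v hv
    rw [abs_div, div_le_iff₀ (hp hq v hv)]
    exact le_trans (by linarith) (hz hq v hv)
  have hnorm := hS.tendsto_arm_mean (φ := fun v z => 1 / den v z.1)
    (fun v => measurable_const.div ((hdenm v).comp measurable_fst)) hU hB
    (by
      filter_upwards [hBd, hpos] with z hz hp hq v hv
      rw [abs_div, abs_one, div_le_iff₀ (hp hq v hv)]
      exact le_trans (by linarith [abs_nonneg (z.2.2 - (OR k).mean z.1 q (v.1.2 k))]) (hz hq v hv))
    (by
      filter_upwards [hpos] with z hp hq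
      exact continuousOn_const.div (hdenc z.1).continuousOn fun v hv => abs_pos.1 (hp hq v hv))
    hulim
  have hres := hS.tendsto_arm_mean hres_m hU hB hres_dom
    (by
      filter_upwards [hpos] with z hp hq
      refine ContinuousOn.div ?_ (hdenc z.1).continuousOn fun v hv => abs_pos.1 (hp hq v hv)
      exact (continuous_const.sub (((OR k).continuous z.1 q).comp
        ((continuous_apply k).comp continuous_fst.snd))).continuousOn)
    hulim
  have hnorm0 : ∫ ω, S.ind q 0 ω * (1 / den (γ, c, ρ) (S.obs 0 ω).1) ∂P ≠ 0 := by
    refine fun h0 => hreg.normaliser_ne_zero (Eq.trans ?_ h0)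
    refine integral_congr_ae (ae_of_all _ fun ω => ?_)
    exact div_eq_mul_one_div _ _
  have hres0 : ∫ ω, S.ind q 0 ω * (((S.obs 0 ω).2.2 - (OR k).mean (S.obs 0 ω).1 q (γ.2 k)) /
      den (γ, c, ρ) (S.obs 0 ω).1) ∂P = 0 := by
    have hform : ∀ ω, S.ind q 0 ω * (((S.obs 0 ω).2.2 - (OR k).mean (S.obs 0 ω).1 q (γ.2 k)) /
        den (γ, c, ρ) (S.obs 0 ω).1) = S.ind q 0 ω * (1 / den (γ, c, ρ) (S.X 0 ω)) *
        (S.Y 0 ω - (OR k).mean (S.X 0 ω) q (γ.2 k)) := fun ω => by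
      change S.ind q 0 ω * ((S.Y 0 ω - (OR k).mean (S.X 0 ω) q (γ.2 k)) /
        den (γ, c, ρ) (S.X 0 ω)) = _
      ring
    simp only [hform]
    refine hS.integral_residual hk (measurable_const.div (hdenm _)) ?_
    refine Integrable.congr ?_ (ae_of_all _ hform)
    refine hS.integrable_of_dominated hB ((hS.measurable_ind q 0).mul
      ((hres_m (γ, c, ρ)).comp (hS.measurable_obs 0))).aestronglyMeasurable ?_
    filter_upwards [hS.ae_of_ae_obsLaw hres_dom] with ω hω
    by_cases hq : S.D 0 ω = q
    · have h1 := hω hq _ (mem_of_mem_nhds hU)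
      have h2 : S.ind q 0 ω = 1 := if_pos hq
      rw [h2, one_mul]
      exact h1.trans (le_abs_self _)
    · have h2 : S.ind q 0 ω = 0 := if_neg hq
      rw [h2, zero_mul, abs_zero]
      exact abs_nonneg _
  rw [hres0] at hres
  have hlim := (hres.div hnorm hnorm0).add ((tendsto_pi_nhds.1 hcentre) (Sum.inr k))
  rw [zero_div, zero_add, ← hc, hck] at hlim
  refine hlim.congr' ?_
  filter_upwards [hroot, hnorm.eventually_ne hnorm0,
    eventually_inProb_of_atTop (eventually_gt_atTop 0)] with x hx hne hn
  have hn' : (x.1 : ℝ) ≠ 0 := by exact_mod_cast hn.ne'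
  rw [hx.muMR_eq k (fun h0 => hne ?_)]
  · simp only [Pi.div_apply]
    rw [div_div_div_cancel_right₀ hn']
    rfl
  · have : ∑ i ∈ S.arm q x.1 x.2, 1 / den (u x) (S.obs i x.2).1 = 0 := h0
    rw [this, zero_div]

end OutcomeRegression

/-! ### Robustness to the propensity score models -/

section Score

variable {Ω : Type*} {p Q J K : ℕ} {PS : Fin J → PSModel p Q} {OR : Fin K → ORModel p Q}
  {q : Fin Q} {S : Sample Ω p Q}

/-- The moment function `{f(x; γ) - t} / πʲ(x, q; αʲ)` of the empirical likelihood problem, at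
`u = (γ, t)`. -/
noncomputable def score (q : Fin Q) (j : Fin J) (u : Params PS OR × Vec J K)
    (x : EuclideanSpace ℝ (Fin p)) : Vec J K :=
  (1 / (PS j).prob x q (u.1.1 j)) • (modelVec PS OR q u.1 x - u.2)

theorem hHat_eq_score (j : Fin J) (γ : Params PS OR) (n : ℕ) (ω : Ω) (i : ℕ) :
    hHat PS OR q S j γ n ω i = score q j (γ, centreHat PS OR q S γ n ω) (S.X i ω) := rfl

theorem score_apply (j : Fin J) (u : Params PS OR × Vec J K) (x : EuclideanSpace ℝ (Fin p))
    (l : Fin J ⊕ Fin K) : score q j u x l =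
      modelVec PS OR q u.1 x l / (PS j).prob x q (u.1.1 j) -
        u.2 l * (1 / (PS j).prob x q (u.1.1 j)) := by
  simp only [score, Pi.smul_apply, Pi.sub_apply, smul_eq_mul]
  ring

theorem measurable_score (j : Fin J) (u : Params PS OR × Vec J K) (l : Fin J ⊕ Fin K) :
    Measurable (fun x => score q j u x l) := by
  simp only [score_apply]
  exact ((measurable_modelVec u.1 l).div ((PS j).measurable q _)).sub
    (measurable_const.mul (measurable_const.div ((PS j).measurable q _)))

/-- The substitution `ρ = (l + e_j) / θ̂ʲ` turns the denominators of the estimating equation into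
those of the empirical likelihood problem. -/
theorem one_add_rhoPi_dotProduct (j : Fin J) (γ : Params PS OR) (lam : Vec J K) (n : ℕ) (ω : Ω)
    (i : ℕ) (hθ : centreHat PS OR q S γ n ω (Sum.inl j) ≠ 0)
    (hπ : (PS j).prob (S.X i ω) q (γ.1 j) ≠ 0) :
    1 + rhoPi PS OR q S j γ lam n ω ⬝ᵥ gHat PS OR q S γ n ω i =
      (PS j).prob (S.X i ω) q (γ.1 j) * (1 + lam ⬝ᵥ hHat PS OR q S j γ n ω i) /
        centreHat PS OR q S γ n ω (Sum.inl j) := by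
  have h1 : rhoPi PS OR q S j γ lam n ω =
      (1 / centreHat PS OR q S γ n ω (Sum.inl j)) • (lam + Pi.single (Sum.inl j) 1) := by
    funext l
    simp only [rhoPi, Pi.smul_apply, Pi.add_apply, smul_eq_mul, Pi.single_apply]
    rw [one_div, inv_mul_eq_div]
  rw [h1, hHat, smul_dotProduct, add_dotProduct, single_dotProduct, dotProduct_smul]
  have h2 : gHat PS OR q S γ n ω i (Sum.inl j) =
      (PS j).prob (S.X i ω) q (γ.1 j) - centreHat PS OR q S γ n ω (Sum.inl j) := rfl
  rw [h2]
  simp only [smul_eq_mul]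
  field_simp
  ring

theorem IsRoot.rhoPi {j : Fin J} {γ : Params PS OR} {lam : Vec J K} {n : ℕ} {ω : Ω}
    (h : IsRoot (S.arm q n ω) (hHat PS OR q S j γ n ω) lam)
    (hθ : centreHat PS OR q S γ n ω (Sum.inl j) ≠ 0)
    (hπ : ∀ i ∈ S.arm q n ω, (PS j).prob (S.X i ω) q (γ.1 j) ≠ 0) :
    IsRoot (S.arm q n ω) (gHat PS OR q S γ n ω) (rhoPi PS OR q S j γ lam n ω) := by
  refine ⟨fun i hi => ?_, ?_⟩
  · rw [one_add_rhoPi_dotProduct j γ lam n ω i hθ (hπ i hi)]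
    exact div_ne_zero (mul_ne_zero (hπ i hi) (h.1 i hi)) hθ
  · have h1 : ∀ i ∈ S.arm q n ω,
        (1 / (1 + MultiplyRobust.rhoPi PS OR q S j γ lam n ω ⬝ᵥ gHat PS OR q S γ n ω i)) •
          gHat PS OR q S γ n ω i = centreHat PS OR q S γ n ω (Sum.inl j) •
          ((1 / (1 + lam ⬝ᵥ hHat PS OR q S j γ n ω i)) • hHat PS OR q S j γ n ω i) := by
      intro i hi
      rw [one_add_rhoPi_dotProduct j γ lam n ω i hθ (hπ i hi)]
      have ha := hπ i hi
      have hb := h.1 i hi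
      generalize 1 + lam ⬝ᵥ hHat PS OR q S j γ n ω i = d at hb ⊢
      rw [hHat, smul_smul, smul_smul]
      congr 1
      field_simp
    rw [Finset.sum_congr rfl h1, ← Finset.smul_sum, h.2, smul_zero]

theorem muMR_rhoPi {j : Fin J} {γ : Params PS OR} {lam : Vec J K} {n : ℕ} {ω : Ω}
    (hθ : centreHat PS OR q S γ n ω (Sum.inl j) ≠ 0)
    (hπ : ∀ i ∈ S.arm q n ω, (PS j).prob (S.X i ω) q (γ.1 j) ≠ 0) :
    muMR PS OR q S γ (rhoPi PS OR q S j γ lam n ω) n ω =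
      (∑ i ∈ S.arm q n ω, S.Y i ω / (PS j).prob (S.X i ω) q (γ.1 j) /
        (1 + lam ⬝ᵥ hHat PS OR q S j γ n ω i)) /
      ∑ i ∈ S.arm q n ω, 1 / (PS j).prob (S.X i ω) q (γ.1 j) /
        (1 + lam ⬝ᵥ hHat PS OR q S j γ n ω i) := by
  rw [muMR_eq_div, ← mul_div_mul_left _ (∑ i ∈ S.arm q n ω, 1 / (PS j).prob (S.X i ω) q (γ.1 j) /
    (1 + lam ⬝ᵥ hHat PS OR q S j γ n ω i)) hθ, Finset.mul_sum, Finset.mul_sum]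
  congr 1
  · refine Finset.sum_congr rfl fun i hi => ?_
    rw [one_add_rhoPi_dotProduct j γ lam n ω i hθ (hπ i hi), div_div, div_div_eq_mul_div]
    ring
  · refine Finset.sum_congr rfl fun i hi => ?_
    rw [one_add_rhoPi_dotProduct j γ lam n ω i hθ (hπ i hi), div_div, div_div_eq_mul_div]
    ring

theorem abs_dotProduct_le {a : ℝ} {v w : Vec J K} (hw : ∀ l, |w l| ≤ a) :
    |v ⬝ᵥ w| ≤ Fintype.card (Fin J ⊕ Fin K) * a * ‖v‖ := by
  calc |v ⬝ᵥ w| ≤ ∑ l, |v l * w l| := Finset.abs_sum_le_sum_abs _ _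
    _ ≤ ∑ _l : Fin J ⊕ Fin K, ‖v‖ * a := Finset.sum_le_sum fun l _ => by
        rw [abs_mul]
        exact mul_le_mul (norm_le_pi_norm v l) (hw l) (abs_nonneg _) (norm_nonneg _)
    _ = _ := by rw [Finset.sum_const, Finset.card_univ, nsmul_eq_mul]; ring

/-- A quadratic form that is positive on a subspace is bounded below there by a multiple of the
squared norm. -/
theorem exists_quadratic_lower_bound (V : Submodule ℝ (Vec J K))
    (A : Fin J ⊕ Fin K → Fin J ⊕ Fin K → ℝ)
    (hpos : ∀ v ∈ V, v ≠ 0 → 0 < ∑ l, ∑ l', v l * v l' * A l l') :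
    ∃ κ > 0, ∀ v ∈ V, κ * ‖v‖ ^ 2 ≤ ∑ l, ∑ l', v l * v l' * A l l' := by
  set F : Vec J K → ℝ := fun v => ∑ l, ∑ l', v l * v l' * A l l' with hF
  have hFc : Continuous F := by fun_prop
  set C : Set (Vec J K) := (V : Set (Vec J K)) ∩ Metric.sphere 0 1 with hC
  have hCc : IsCompact C := (isCompact_sphere 0 1).inter_left V.closed_of_finiteDimensional
  obtain ⟨κ, hκ, hκC⟩ : ∃ κ > 0, ∀ v ∈ C, κ ≤ F v := by
    rcases C.eq_empty_or_nonempty with h | h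
    · exact ⟨1, one_pos, fun v hv => by simp [h] at hv⟩
    · obtain ⟨v, hv, hmin⟩ := hCc.exists_isMinOn h hFc.continuousOn
      refine ⟨F v, hpos v hv.1 fun h0 => ?_, fun w hw => hmin hw⟩
      have := hv.2
      simp [h0] at this
  refine ⟨κ, hκ, fun v hv => ?_⟩
  rcases eq_or_ne v 0 with rfl | h0
  · simp
  · have hn : ‖v‖ ≠ 0 := norm_ne_zero_iff.2 h0
    have h1 := hκC (‖v‖⁻¹ • v) ⟨V.smul_mem _ hv, by simp [norm_smul, hn]⟩
    have h2 : F (‖v‖⁻¹ • v) = (‖v‖ ^ 2)⁻¹ * F v := by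
      simp only [hF, Finset.mul_sum, Pi.smul_apply, smul_eq_mul]
      refine Finset.sum_congr rfl fun l _ => Finset.sum_congr rfl fun l' _ => ?_
      field_simp
    rw [h2, inv_mul_eq_div, le_div_iff₀ (by positivity)] at h1
    exact h1

theorem sum_sq_dotProduct (M : Finset ℕ) (h : ℕ → Vec J K) (v : Vec J K) :
    ∑ i ∈ M, (v ⬝ᵥ h i) ^ 2 = ∑ l, ∑ l', v l * v l' * ∑ i ∈ M, h i l * h i l' := by
  simp only [dotProduct, sq, Finset.sum_mul_sum]
  rw [Finset.sum_comm]
  refine Finset.sum_congr rfl fun l _ => ?_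
  rw [Finset.sum_comm]
  refine Finset.sum_congr rfl fun l' _ => ?_
  rw [Finset.mul_sum]
  exact Finset.sum_congr rfl fun i _ => by ring

theorem abs_quadratic_sub_le {A A' : Fin J ⊕ Fin K → Fin J ⊕ Fin K → ℝ} (v : Vec J K) :
    |∑ l, ∑ l', v l * v l' * A l l' - ∑ l, ∑ l', v l * v l' * A' l l'| ≤
      (∑ l, ∑ l', |A l l' - A' l l'|) * ‖v‖ ^ 2 := by
  simp only [← Finset.sum_sub_distrib, Finset.sum_mul]
  refine (Finset.abs_sum_le_sum_abs _ _).trans (Finset.sum_le_sum fun l _ => ?_)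
  refine (Finset.abs_sum_le_sum_abs _ _).trans (Finset.sum_le_sum fun l' _ => ?_)
  rw [← mul_sub, abs_mul, abs_mul, mul_comm, sq]
  exact mul_le_mul_of_nonneg_left (mul_le_mul (norm_le_pi_norm v l) (norm_le_pi_norm v l')
    (abs_nonneg _) (norm_nonneg _)) (abs_nonneg _)

/-- Denominators close to one change a sum little. -/
theorem abs_sum_div_one_add_sub_le {M : Finset ℕ} {φ b t : ℕ → ℝ} {e : ℝ} (he : e ≤ 1 / 2)
    (hb : ∀ i ∈ M, |φ i| ≤ b i) (ht : ∀ i ∈ M, |t i| ≤ e) :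
    |∑ i ∈ M, φ i / (1 + t i) - ∑ i ∈ M, φ i| ≤ 2 * e * ∑ i ∈ M, b i := by
  rw [← Finset.sum_sub_distrib, Finset.mul_sum]
  refine (Finset.abs_sum_le_sum_abs _ _).trans (Finset.sum_le_sum fun i hi => ?_)
  have h1 := abs_le.1 (ht i hi)
  have hp : 1 / 2 ≤ 1 + t i := by linarith
  have h2 : φ i / (1 + t i) - φ i = -(t i * φ i) / (1 + t i) := by
    field_simp; ring
  rw [h2, abs_div, abs_neg, abs_mul, abs_of_pos (by linarith : 0 < 1 + t i),
    div_le_iff₀ (by linarith)]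
  have h3 : |t i| * |φ i| ≤ e * b i :=
    mul_le_mul (ht i hi) (hb i hi) (abs_nonneg _) ((abs_nonneg _).trans (ht i hi))
  have h4 : 0 ≤ e * b i := (mul_nonneg (abs_nonneg _) (abs_nonneg _)).trans h3
  nlinarith

/-- Bookkeeping for the mean of the moment functions at the fitted parameters, `a' - t' b'`, around
its population value `c - c · 1 = 0`. -/
theorem abs_sub_mul_le {a a' b b' c t t' e : ℝ} (ha : |a' - a| ≤ e) (hb : |b' - b| ≤ e)
    (ht : |t' - t| ≤ e) :
    |a' - t' * b'| ≤ e + |a - c| + (e + |t - c|) * |b'| + |c| * (e + |b - 1|) := by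
  have h1 : a' - t' * b' = (a' - a) + (a - c) - ((t' - t) + (t - c)) * b' -
      c * ((b' - b) + (b - 1)) := by ring
  rw [h1]
  refine (abs_sub _ _).trans (add_le_add ((abs_sub _ _).trans (add_le_add ?_ ?_)) ?_)
  · exact (abs_add_le _ _).trans (by linarith)
  · rw [abs_mul]
    exact mul_le_mul_of_nonneg_right ((abs_add_le _ _).trans (by linarith)) (abs_nonneg _)
  · rw [abs_mul]
    exact mul_le_mul_of_nonneg_left ((abs_add_le _ _).trans (by linarith)) (abs_nonneg _)

end Score

section PropensityScore

variable {Ω : Type*} [MeasurableSpace Ω] {P : Measure Ω} {p Q J K : ℕ}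
  {PS : Fin J → PSModel p Q} {OR : Fin K → ORModel p Q} {q : Fin Q} {S : Sample Ω p Q}

/-- The local part of `RegularPS` for given envelopes. -/
structure LocallyRegular (PS : Fin J → PSModel p Q) (OR : Fin K → ORModel p Q) (q : Fin Q)
    (S : Sample Ω p Q) (P : Measure Ω) (j : Fin J) (γ : Params PS OR) (U : Set (Params PS OR))
    (H B L : EuclideanSpace ℝ (Fin p) × Fin Q × ℝ → ℝ) : Prop where
  mem_nhds : U ∈ 𝓝 γ
  memLp : MemLp H 2 (S.obsLaw P)
  integrable_outcome : Integrable B (S.obsLaw P)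
  integrable_lipschitz : Integrable L (S.obsLaw P)
  treated : ∀ᵐ z ∂(S.obsLaw P), z.2.1 = q → ∀ γ' ∈ U,
    1 ≤ H z * (PS j).prob z.1 q (γ'.1 j) ∧
    (∀ l, |modelVec PS OR q γ' z.1 l| ≤ H z * (PS j).prob z.1 q (γ'.1 j)) ∧
    |z.2.2| ≤ B z * (PS j).prob z.1 q (γ'.1 j) ∧
    |1 / (PS j).prob z.1 q (γ'.1 j) - 1 / (PS j).prob z.1 q (γ.1 j)| ≤ L z * dist γ' γ ∧
    ∀ l, |modelVec PS OR q γ' z.1 l / (PS j).prob z.1 q (γ'.1 j) -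
      modelVec PS OR q γ z.1 l / (PS j).prob z.1 q (γ.1 j)| ≤ L z * dist γ' γ
  lipschitz : ∀ᵐ z ∂(S.obsLaw P), ∀ γ' ∈ U, ∀ l,
    |modelVec PS OR q γ' z.1 l - modelVec PS OR q γ z.1 l| ≤ L z * dist γ' γ
  constant : ∀ v : Vec J K, (∃ c : ℝ, ∀ᵐ z ∂(S.obsLaw P), v ⬝ᵥ modelVec PS OR q γ z.1 = c) →
    ∃ c : Params PS OR → ℝ, ∀ᵐ z ∂(S.obsLaw P), ∀ γ' ∈ U, v ⬝ᵥ modelVec PS OR q γ' z.1 = c γ'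

variable {j : Fin J} {γ : Params PS OR} {U : Set (Params PS OR)}
  {H B L : EuclideanSpace ℝ (Fin p) × Fin Q × ℝ → ℝ} {γhat : ℕ × Ω → Params PS OR}

theorem LocallyRegular.treated_bounds (hR : LocallyRegular PS OR q S P j γ U H B L) :
    ∀ᵐ z ∂(S.obsLaw P), z.2.1 = q → ∀ γ' ∈ U, 0 < (PS j).prob z.1 q (γ'.1 j) ∧ 0 ≤ H z ∧
      |1 / (PS j).prob z.1 q (γ'.1 j)| ≤ H z ∧
      (∀ l, |modelVec PS OR q γ' z.1 l / (PS j).prob z.1 q (γ'.1 j)| ≤ H z) ∧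
      |z.2.2 / (PS j).prob z.1 q (γ'.1 j)| ≤ B z := by
  filter_upwards [hR.treated] with z hz hq γ' hγ'
  obtain ⟨h1, h2, h3, -, -⟩ := hz hq γ' hγ'
  have hpos : 0 < (PS j).prob z.1 q (γ'.1 j) := by
    refine lt_of_le_of_ne ((PS j).nonneg _ _ _) fun h0 => ?_
    rw [← h0, mul_zero] at h1
    linarith
  refine ⟨hpos, ?_, ?_, fun l => ?_, ?_⟩
  · by_contra hneg
    nlinarith
  · rw [abs_div, abs_one, abs_of_pos hpos, div_le_iff₀ hpos]; exact h1
  · rw [abs_div, abs_of_pos hpos, div_le_iff₀ hpos]; exact h2 l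
  · rw [abs_div, abs_of_pos hpos, div_le_iff₀ hpos]; exact h3

theorem LocallyRegular.score_bound (hR : LocallyRegular PS OR q S P j γ U H B L) :
    ∀ᵐ z ∂(S.obsLaw P), z.2.1 = q → ∀ γ' ∈ U, ∀ t l,
      |score q j (γ', t) z.1 l| ≤ H z * (1 + ‖t‖) := by
  filter_upwards [hR.treated_bounds] with z hz hq γ' hγ' t l
  obtain ⟨-, h0, h1, h2, -⟩ := hz hq γ' hγ'
  rw [score_apply]
  refine (abs_sub _ _).trans ?_
  rw [abs_mul, mul_add, mul_one, mul_comm (H z)]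
  exact add_le_add (h2 l) (mul_le_mul (norm_le_pi_norm t l) h1 (abs_nonneg _) (norm_nonneg _))

theorem LocallyRegular.score_mul_bound (hR : LocallyRegular PS OR q S P j γ U H B L)
    (c : Vec J K) (l l' : Fin J ⊕ Fin K) :
    ∀ᵐ z ∂(S.obsLaw P), z.2.1 = q → ∀ u ∈ U ×ˢ Metric.ball c 1,
      |score q j u z.1 l * score q j u z.1 l'| ≤ (2 + ‖c‖) ^ 2 * H z ^ 2 := by
  filter_upwards [hR.score_bound, hR.treated_bounds] with z hz hz' hq u hu
  have hH : 0 ≤ H z := (hz' hq u.1 hu.1).2.1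
  have hn : ‖u.2‖ ≤ 1 + ‖c‖ := by
    have h1 := hu.2
    rw [mem_ball_iff_norm] at h1
    linarith [norm_sub_norm_le u.2 c]
  have h : ∀ l, |score q j u z.1 l| ≤ H z * (2 + ‖c‖) := fun l =>
    (hz hq u.1 hu.1 u.2 l).trans (mul_le_mul_of_nonneg_left (by linarith) hH)
  rw [abs_mul]
  calc |score q j u z.1 l| * |score q j u z.1 l'| ≤ (H z * (2 + ‖c‖)) * (H z * (2 + ‖c‖)) :=
        mul_le_mul (h l) (h l') (abs_nonneg _) ((abs_nonneg _).trans (h l))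
    _ = _ := by ring

variable [StandardBorelSpace Ω] [IsProbabilityMeasure P]

theorem ind_mul_dominated (hS : S.Identified P q)
    {C φ : EuclideanSpace ℝ (Fin p) × Fin Q × ℝ → ℝ} (hC : Integrable C (S.obsLaw P))
    (hm : Measurable φ) (h : ∀ᵐ z ∂(S.obsLaw P), z.2.1 = q → |φ z| ≤ C z) :
    Integrable (fun ω => S.ind q 0 ω * φ (S.obs 0 ω)) P := by
  refine hS.integrable_of_dominated hC
    ((hS.measurable_ind q 0).mul (hm.comp (hS.measurable_obs 0))).aestronglyMeasurable ?_
  filter_upwards [hS.ae_of_ae_obsLaw h] with ω hω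
  by_cases hq : S.D 0 ω = q
  · rw [show S.ind q 0 ω = 1 from if_pos hq, one_mul]
    exact (hω hq).trans (le_abs_self _)
  · rw [show S.ind q 0 ω = 0 from if_neg hq, zero_mul, abs_zero]
    exact abs_nonneg _

/-- The models are square integrable under the marginal law of the covariates, because
`E f² = E[I_q f² / π] ≤ E[H² π] ≤ E H²`. -/
theorem LocallyRegular.integrable_sq (hR : LocallyRegular PS OR q S P j γ U H B L)
    (hS : S.Identified P q) (hα : (PS j).IsTrueValue S P (γ.1 j)) (l : Fin J ⊕ Fin K) :
    Integrable (fun ω => modelVec PS OR q γ (S.X 0 ω) l ^ 2) P := by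
  have hm : Measurable (fun v : ℝ × EuclideanSpace ℝ (Fin p) => modelVec PS OR q γ v.2 l ^ 2) :=
    ((measurable_modelVec γ l).comp measurable_snd).pow_const 2
  refine (hS.integrable_ipw_iff hα hm).1 ?_
  refine ind_mul_dominated hS (φ := fun z => modelVec PS OR q γ z.1 l ^ 2 /
    (PS j).prob z.1 q (γ.1 j)) hR.memLp.integrable_sq
    ((((measurable_modelVec γ l).pow_const 2).div ((PS j).measurable q _)).comp measurable_fst) ?_
  filter_upwards [hR.treated_bounds] with z hz hq
  obtain ⟨h0, h1, -, h2, -⟩ := hz hq γ (mem_of_mem_nhds hR.mem_nhds)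
  have h3 : (PS j).prob z.1 q (γ.1 j) ≤ 1 := by
    rw [← (PS j).sum_eq_one z.1 (γ.1 j)]
    exact Finset.single_le_sum (fun d _ => (PS j).nonneg z.1 d (γ.1 j)) (Finset.mem_univ q)
  have h4 : modelVec PS OR q γ z.1 l ^ 2 / (PS j).prob z.1 q (γ.1 j) =
      |modelVec PS OR q γ z.1 l / (PS j).prob z.1 q (γ.1 j)| ^ 2 *
        (PS j).prob z.1 q (γ.1 j) := by
    rw [sq_abs]; field_simp
  rw [h4, abs_of_nonneg (by positivity)]
  calc _ ≤ H z ^ 2 * 1 := by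
        gcongr
        exact h2 l
    _ = H z ^ 2 := mul_one _

theorem LocallyRegular.memLp_modelVec (hR : LocallyRegular PS OR q S P j γ U H B L)
    (hS : S.Identified P q) (hα : (PS j).IsTrueValue S P (γ.1 j)) (l : Fin J ⊕ Fin K) :
    MemLp (fun z => modelVec PS OR q γ z.1 l) 2 (S.obsLaw P) := by
  have hm : Measurable (fun z : EuclideanSpace ℝ (Fin p) × Fin Q × ℝ =>
    modelVec PS OR q γ z.1 l) := (measurable_modelVec γ l).comp measurable_fst
  rw [memLp_two_iff_integrable_sq hm.aestronglyMeasurable]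
  exact (integrable_map_measure (hm.pow_const 2).aestronglyMeasurable
    (hS.measurable_obs 0).aemeasurable).2 (hR.integrable_sq hS hα l)

theorem LocallyRegular.tendsto_centreHat (hR : LocallyRegular PS OR q S P j γ U H B L)
    (hS : S.Identified P q) (hα : (PS j).IsTrueValue S P (γ.1 j))
    (hγ : Tendsto γhat (inProb P) (𝓝 γ)) :
    Tendsto (fun x : ℕ × Ω => centreHat PS OR q S (γhat x) x.1 x.2) (inProb P)
      (𝓝 (centre PS OR q S P γ)) := by
  have : IsProbabilityMeasure (S.obsLaw P) :=
    Measure.isProbabilityMeasure_map (hS.measurable_obs 0).aemeasurable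
  refine hS.tendsto_centreHat ⟨U ∩ Metric.ball γ 1,
    inter_mem hR.mem_nhds (Metric.ball_mem_nhds _ one_pos),
    fun z => (∑ l, |modelVec PS OR q γ z.1 l|) + |L z|,
    (integrable_finsetSum _ fun l _ =>
      ((hR.memLp_modelVec hS hα l).integrable (by norm_num)).abs).add
      hR.integrable_lipschitz.abs, ?_⟩ hγ
  filter_upwards [hR.lipschitz] with z hz γ' hγ' l
  have h1 := hz γ' hγ'.1 l
  have h2 : dist γ' γ ≤ 1 := le_of_lt hγ'.2
  have h3 : L z * dist γ' γ ≤ |L z| := by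
    calc L z * dist γ' γ ≤ |L z| * 1 :=
          mul_le_mul (le_abs_self _) h2 dist_nonneg (abs_nonneg _)
      _ = |L z| := mul_one _
  have h4 : |modelVec PS OR q γ z.1 l| ≤ ∑ l, |modelVec PS OR q γ z.1 l| :=
    Finset.single_le_sum (f := fun l => |modelVec PS OR q γ z.1 l|)
      (fun _ _ => abs_nonneg _) (Finset.mem_univ l)
  have h5 := abs_sub_abs_le_abs_sub (modelVec PS OR q γ' z.1 l) (modelVec PS OR q γ z.1 l)
  linarith

theorem centre_inl_pos (hS : S.Identified P q) (hα : (PS j).IsTrueValue S P (γ.1 j)) :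
    0 < centre PS OR q S P γ (Sum.inl j) := by
  have h1 : centre PS OR q S P γ (Sum.inl j) = ∫ ω, S.gps P q ω ∂P := integral_congr_ae (hα q)
  rw [h1]
  refine lt_of_le_of_ne (integral_nonneg_of_ae hS.gps_nonneg) fun h0 => ?_
  have h2 := (integral_eq_zero_iff_of_nonneg_ae hS.gps_nonneg integrable_condExp).1 h0.symm
  obtain ⟨ω, hω, hω'⟩ := (h2.and hS.positivity).exists
  exact hω'.ne' hω

/-! #### Inverse probability weighted means at the fitted parameters -/

theorem LocallyRegular.tendsto_inv_prob_mean (hR : LocallyRegular PS OR q S P j γ U H B L)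
    (hS : S.Identified P q) (hα : (PS j).IsTrueValue S P (γ.1 j))
    (hγ : Tendsto γhat (inProb P) (𝓝 γ)) :
    Tendsto (fun x : ℕ × Ω => (∑ i ∈ S.arm q x.1 x.2,
      1 / (PS j).prob (S.X i x.2) q ((γhat x).1 j)) / x.1) (inProb P) (𝓝 1) := by
  have : IsProbabilityMeasure (S.obsLaw P) :=
    Measure.isProbabilityMeasure_map (hS.measurable_obs 0).aemeasurable
  have h := hS.tendsto_arm_mean
    (φ := fun (γ' : Params PS OR) z => 1 / (PS j).prob z.1 q (γ'.1 j))
    (fun γ' => (measurable_const.div ((PS j).measurable q _)).comp measurable_fst) hR.mem_nhds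
    (hR.memLp.integrable (by norm_num))
    (by filter_upwards [hR.treated_bounds] with z hz hq γ' hγ' using (hz hq γ' hγ').2.2.1)
    (by
      filter_upwards [hR.treated_bounds] with z hz hq
      exact continuousOn_const.div (continuous_prob j z.1).continuousOn
        fun γ' hγ' => (hz hq γ' hγ').1.ne') hγ
  have h1 := hS.integral_ipw hα (φ := fun _ => 1) measurable_const
  simp only [integral_const, probReal_univ, smul_eq_mul, mul_one] at h1
  have h2 : ∫ ω, S.ind q 0 ω * (1 / (PS j).prob (S.obs 0 ω).1 q (γ.1 j)) ∂P = 1 := h1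
  rw [h2] at h
  exact h

theorem LocallyRegular.tendsto_ipw_outcome_mean (hR : LocallyRegular PS OR q S P j γ U H B L)
    (hS : S.Identified P q) (hα : (PS j).IsTrueValue S P (γ.1 j))
    (hγ : Tendsto γhat (inProb P) (𝓝 γ)) :
    Tendsto (fun x : ℕ × Ω => (∑ i ∈ S.arm q x.1 x.2,
      S.Y i x.2 / (PS j).prob (S.X i x.2) q ((γhat x).1 j)) / x.1) (inProb P)
      (𝓝 (S.apo P q)) := by
  have h := hS.tendsto_arm_mean
    (φ := fun (γ' : Params PS OR) z => z.2.2 / (PS j).prob z.1 q (γ'.1 j))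
    (fun γ' => measurable_snd.snd.div (((PS j).measurable q _).comp measurable_fst)) hR.mem_nhds
    hR.integrable_outcome
    (by filter_upwards [hR.treated_bounds] with z hz hq γ' hγ' using (hz hq γ' hγ').2.2.2.2)
    (by
      filter_upwards [hR.treated_bounds] with z hz hq
      exact continuousOn_const.div (continuous_prob j z.1).continuousOn
        fun γ' hγ' => (hz hq γ' hγ').1.ne') hγ
  have h1 := hS.integral_ipw hα (φ := fun v => v.1) measurable_fst
  rw [Sample.apo, ← h1]
  exact h

/-- `n^{-1/2}`-rate for means over the treatment arm. -/
theorem arm_mean_rootN (hS : S.Identified P q)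
    {φ : EuclideanSpace ℝ (Fin p) × Fin Q × ℝ → ℝ} (hm : Measurable φ)
    (hH : MemLp H 2 (S.obsLaw P)) (hdom : ∀ᵐ z ∂(S.obsLaw P), z.2.1 = q → |φ z| ≤ H z) :
    RootNConsistent P (fun n ω => (∑ i ∈ S.arm q n ω, φ (S.obs i ω)) / n)
      (∫ ω, S.ind q 0 ω * φ (S.obs 0 ω) ∂P) := by
  have hmeas : Measurable fun z : EuclideanSpace ℝ (Fin p) × Fin Q × ℝ =>
      if z.2.1 = q then φ z else 0 :=
    Measurable.ite (measurable_snd.fst (measurableSet_singleton q)) hm measurable_const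
  have hL : MemLp (fun z : EuclideanSpace ℝ (Fin p) × Fin Q × ℝ =>
      if z.2.1 = q then φ z else 0) 2 (S.obsLaw P) := by
    refine hH.mono hmeas.aestronglyMeasurable ?_
    filter_upwards [hdom] with z hz
    split_ifs with hq
    · exact (hz hq).trans (le_abs_self _)
    · simp
  have h := hS.isIID_obs.sq_integrable_mean_rootN hmeas hL
  convert h using 1
  · funext n ω
    rw [Sample.arm, Finset.sum_filter]
    rfl
  · have h1 := hS.integral_obsLaw hmeas
    rw [Sample.obsLaw] at h1
    rw [h1]
    refine integral_congr_ae (ae_of_all _ fun ω => ?_)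
    change (if S.D 0 ω = q then (1 : ℝ) else 0) * _ = if S.D 0 ω = q then _ else _
    split_ifs <;> simp

/-- The mean of the moment functions is `O_p(n^{-1/2})` and their envelope is `o_p(n^{1/2})`. -/
theorem LocallyRegular.tendsto_score_mean_mul (hR : LocallyRegular PS OR q S P j γ U H B L)
    (hS : S.Identified P q) (hα : (PS j).IsTrueValue S P (γ.1 j))
    {γhat : ℕ → Ω → Params PS OR} (hγ : Tendsto (fun x => γhat x.1 x.2) (inProb P) (𝓝 γ))
    (hroot : RootNConsistent P γhat γ) (l : Fin J ⊕ Fin K) :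
    Tendsto (fun x : ℕ × Ω => |(∑ i ∈ S.arm q x.1 x.2,
      hHat PS OR q S j (γhat x.1 x.2) x.1 x.2 i l) / x.1| * runningMax H S.obs x)
      (inProb P) (𝓝 0) := by
  have hprob : IsProbabilityMeasure (S.obsLaw P) :=
    Measure.isProbabilityMeasure_map (hS.measurable_obs 0).aemeasurable
  have hγU : γ ∈ U := mem_of_mem_nhds hR.mem_nhds
  have hM := hS.isIID_obs.tendsto_runningMax_div_sqrt hR.memLp
  set Mx := runningMax H S.obs with hMx
  set c := centre PS OR q S P γ l with hc
  -- the three sample means at the limit `γ`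
  set a : ℕ → Ω → ℝ := fun n ω => (∑ i ∈ S.arm q n ω,
    modelVec PS OR q γ (S.obs i ω).1 l / (PS j).prob (S.obs i ω).1 q (γ.1 j)) / n with ha
  set b : ℕ → Ω → ℝ := fun n ω => (∑ i ∈ S.arm q n ω,
    1 / (PS j).prob (S.obs i ω).1 q (γ.1 j)) / n with hb
  set t : ℕ → Ω → ℝ := fun n ω => (∑ i ∈ Finset.range n,
    modelVec PS OR q γ (S.obs i ω).1 l) / n with ht
  set bhat : ℕ × Ω → ℝ := fun x => (∑ i ∈ S.arm q x.1 x.2,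
    1 / (PS j).prob (S.X i x.2) q ((γhat x.1 x.2).1 j)) / x.1 with hbhat
  have hta : RootNConsistent P a c := by
    have h1 := arm_mean_rootN hS (φ := fun z => modelVec PS OR q γ z.1 l /
      (PS j).prob z.1 q (γ.1 j)) (((measurable_modelVec γ l).div
      ((PS j).measurable q _)).comp measurable_fst) hR.memLp
      (by filter_upwards [hR.treated_bounds] with z hz hq using (hz hq γ hγU).2.2.2.1 l)
    have h2 := hS.integral_ipw hα (φ := fun v => modelVec PS OR q γ v.2 l)
      ((measurable_modelVec γ l).comp measurable_snd)
    have h3 : c = ∫ ω, S.ind q 0 ω * (modelVec PS OR q γ (S.obs 0 ω).1 l /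
      (PS j).prob (S.obs 0 ω).1 q (γ.1 j)) ∂P := h2.symm
    rw [h3]
    exact h1
  have htb : RootNConsistent P b 1 := by
    have h1 := arm_mean_rootN hS (φ := fun z => 1 / (PS j).prob z.1 q (γ.1 j))
      ((measurable_const.div ((PS j).measurable q _)).comp measurable_fst) hR.memLp
      (by filter_upwards [hR.treated_bounds] with z hz hq using (hz hq γ hγU).2.2.1)
    have h2 := hS.integral_ipw hα (φ := fun _ => 1) measurable_const
    simp only [integral_const, probReal_univ, smul_eq_mul, mul_one] at h2
    rw [← h2]
    exact h1
  have htt : RootNConsistent P t c := by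
    have hm : Measurable (fun z : EuclideanSpace ℝ (Fin p) × Fin Q × ℝ =>
      modelVec PS OR q γ z.1 l) := (measurable_modelVec γ l).comp measurable_fst
    have h1 := hS.isIID_obs.sq_integrable_mean_rootN hm (hR.memLp_modelVec hS hα l)
    have h2 := hS.integral_obsLaw hm
    have h3 : c = ∫ z, modelVec PS OR q γ z.1 l ∂(S.obsLaw P) := h2.symm
    rw [h3]
    exact h1
  have hLmean := hS.isIID_obs.law_large_numbers hR.integrable_lipschitz.abs
  set Lm : ℕ × Ω → ℝ := fun x => (∑ i ∈ Finset.range x.1, |L (S.obs i x.2)|) / x.1 with hLm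
  have hbhat1 : Tendsto bhat (inProb P) (𝓝 1) := hR.tendsto_inv_prob_mean hS hα hγ
  have hδ := hLmean.mul (hroot.tendsto_dist_mul hM)
  have hbound := ((hδ.add (hta.tendsto_dist_mul hM)).add
    ((hδ.add (htt.tendsto_dist_mul hM)).mul hbhat1.abs)).add
    ((hδ.add (htb.tendsto_dist_mul hM)).const_mul |c|)
  simp only [mul_zero, add_zero, zero_mul] at hbound
  refine tendsto_of_tendsto_of_tendsto_of_le_of_le' tendsto_const_nhds hbound
    (Eventually.of_forall fun x => mul_nonneg (abs_nonneg _) (runningMax_nonneg _ _ _)) ?_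
  filter_upwards [hγ.eventually_mem hR.mem_nhds,
    eventually_inProb_of_ae (hS.isIID_obs.ae_forall hR.treated),
    eventually_inProb_of_ae (hS.isIID_obs.ae_forall hR.lipschitz)] with x hxU htr hlip
  have hmean : (∑ i ∈ S.arm q x.1 x.2, hHat PS OR q S j (γhat x.1 x.2) x.1 x.2 i l) / x.1 =
      (∑ i ∈ S.arm q x.1 x.2, modelVec PS OR q (γhat x.1 x.2) (S.X i x.2) l /
        (PS j).prob (S.X i x.2) q ((γhat x.1 x.2).1 j)) / x.1 -
      centreHat PS OR q S (γhat x.1 x.2) x.1 x.2 l * bhat x := by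
    simp only [hHat_eq_score, score_apply, Finset.sum_sub_distrib, ← Finset.mul_sum, sub_div,
      hbhat, mul_div_assoc]
  -- differences of means over the arm are at most `Lm · dist`
  have hdiff : ∀ F G : ℕ → ℝ, (∀ i ∈ S.arm q x.1 x.2,
      |F i - G i| ≤ L (S.obs i x.2) * dist (γhat x.1 x.2) γ) →
      |(∑ i ∈ S.arm q x.1 x.2, F i) / x.1 - (∑ i ∈ S.arm q x.1 x.2, G i) / x.1| ≤
        Lm x * dist (γhat x.1 x.2) γ := by
    intro F G hFG
    rw [← sub_div, ← Finset.sum_sub_distrib, abs_div, Nat.abs_cast, hLm]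
    simp only
    rw [div_mul_eq_mul_div, Finset.sum_mul]
    refine div_le_div_of_nonneg_right ?_ (Nat.cast_nonneg _)
    calc |∑ i ∈ S.arm q x.1 x.2, (F i - G i)| ≤ ∑ i ∈ S.arm q x.1 x.2, |F i - G i| :=
          Finset.abs_sum_le_sum_abs _ _
      _ ≤ ∑ i ∈ S.arm q x.1 x.2, |L (S.obs i x.2)| * dist (γhat x.1 x.2) γ :=
          Finset.sum_le_sum fun i hi => (hFG i hi).trans
            (mul_le_mul_of_nonneg_right (le_abs_self _) dist_nonneg)
      _ ≤ _ := Finset.sum_le_sum_of_subset_of_nonneg (Finset.filter_subset _ _)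
          fun i _ _ => mul_nonneg (abs_nonneg _) dist_nonneg
  have h1 := hdiff (fun i => modelVec PS OR q (γhat x.1 x.2) (S.X i x.2) l /
      (PS j).prob (S.X i x.2) q ((γhat x.1 x.2).1 j))
    (fun i => modelVec PS OR q γ (S.obs i x.2).1 l / (PS j).prob (S.obs i x.2).1 q (γ.1 j))
    (fun i hi => (htr i (mem_arm.1 hi).2 _ hxU).2.2.2.2 l)
  have h2 := hdiff (fun i => 1 / (PS j).prob (S.X i x.2) q ((γhat x.1 x.2).1 j))
    (fun i => 1 / (PS j).prob (S.obs i x.2).1 q (γ.1 j))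
    (fun i hi => (htr i (mem_arm.1 hi).2 _ hxU).2.2.2.1)
  have h3 : |centreHat PS OR q S (γhat x.1 x.2) x.1 x.2 l - t x.1 x.2| ≤
      Lm x * dist (γhat x.1 x.2) γ := by
    rw [centreHat_apply, ht, ← sub_div, ← Finset.sum_sub_distrib, abs_div, Nat.abs_cast, hLm]
    simp only
    rw [div_mul_eq_mul_div, Finset.sum_mul]
    refine div_le_div_of_nonneg_right ?_ (Nat.cast_nonneg _)
    refine (Finset.abs_sum_le_sum_abs _ _).trans (Finset.sum_le_sum fun i _ => ?_)
    exact (hlip i _ hxU l).trans (mul_le_mul_of_nonneg_right (le_abs_self _) dist_nonneg)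
  have h4 := abs_sub_mul_le (c := c) h1 h2 h3
  rw [hmean]
  refine (mul_le_mul_of_nonneg_right h4 (runningMax_nonneg H S.obs x)).trans (le_of_eq ?_)
  simp only [Real.dist_eq]
  ring

end PropensityScore

section Multiplier

variable {Ω : Type*} [MeasurableSpace Ω] [StandardBorelSpace Ω] {P : Measure Ω}
  [IsProbabilityMeasure P] {p Q J K : ℕ} {PS : Fin J → PSModel p Q} {OR : Fin K → ORModel p Q}
  {q : Fin Q} {S : Sample Ω p Q} {j : Fin J} {γ : Params PS OR} {U : Set (Params PS OR)}
  {H B L : EuclideanSpace ℝ (Fin p) × Fin Q × ℝ → ℝ} {γhat : ℕ × Ω → Params PS OR}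

/-! #### Degenerate directions -/

/-- The directions `v` in which the models are redundant: `vᵀ f(X; γ)` is almost surely constant. -/
def degenerate (q : Fin Q) (γ : Params PS OR)
    (ν : Measure (EuclideanSpace ℝ (Fin p) × Fin Q × ℝ)) : Submodule ℝ (Vec J K) where
  carrier := {v | ∃ c : ℝ, ∀ᵐ z ∂ν, v ⬝ᵥ modelVec PS OR q γ z.1 = c}
  zero_mem' := ⟨0, ae_of_all _ fun z => zero_dotProduct _⟩
  add_mem' := by
    rintro v w ⟨c, hc⟩ ⟨d, hd⟩
    refine ⟨c + d, ?_⟩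
    filter_upwards [hc, hd] with z h1 h2
    rw [add_dotProduct, h1, h2]
  smul_mem' := by
    rintro a v ⟨c, hc⟩
    refine ⟨a * c, ?_⟩
    filter_upwards [hc] with z h1
    rw [smul_dotProduct, h1, smul_eq_mul]

/-- The orthogonal complement of `N` with respect to the dot product. -/
def dotOrthogonal (N : Submodule ℝ (Vec J K)) : Submodule ℝ (Vec J K) where
  carrier := {v | ∀ w ∈ N, w ⬝ᵥ v = 0}
  zero_mem' := fun w _ => dotProduct_zero w
  add_mem' := fun {v v'} hv hv' w hw => by rw [dotProduct_add, hv w hw, hv' w hw, add_zero]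
  smul_mem' := fun a v hv w hw => by rw [dotProduct_smul, hv w hw, smul_zero]

/-- With probability tending to one the fitted moment functions of the whole sample are orthogonal
to the degenerate directions, since these remain degenerate near `γ`. -/
theorem LocallyRegular.hHat_mem (hR : LocallyRegular PS OR q S P j γ U H B L)
    (hS : S.Identified P q) (hγ : Tendsto γhat (inProb P) (𝓝 γ)) :
    ∀ᶠ x in inProb P, ∀ i ∈ S.arm q x.1 x.2, hHat PS OR q S j (γhat x) x.1 x.2 i ∈
      dotOrthogonal (degenerate q γ (S.obsLaw P)) := by
  obtain ⟨s, hs⟩ := IsNoetherian.noetherian (degenerate q γ (S.obsLaw P))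
  have hsN : ∀ v ∈ s, ∃ c : Params PS OR → ℝ, ∀ᵐ z ∂(S.obsLaw P), ∀ γ' ∈ U,
      v ⬝ᵥ modelVec PS OR q γ' z.1 = c γ' := fun v hv =>
    hR.constant v (hs ▸ Submodule.subset_span hv : v ∈ degenerate q γ (S.obsLaw P))
  choose! c hc using hsN
  have hall : ∀ᵐ z ∂(S.obsLaw P), ∀ v ∈ s, ∀ γ' ∈ U, v ⬝ᵥ modelVec PS OR q γ' z.1 = c v γ' :=
    (Finset.eventually_all s).2 hc
  filter_upwards [hγ.eventually_mem hR.mem_nhds,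
    eventually_inProb_of_ae (hS.isIID_obs.ae_forall hall),
    eventually_inProb_of_atTop (eventually_gt_atTop 0)] with x hxU hx hn i hi w hw
  have hn' : (x.1 : ℝ) ≠ 0 := by exact_mod_cast hn.ne'
  have hg : w ⬝ᵥ gHat PS OR q S (γhat x) x.1 x.2 i = 0 := by
    rw [← hs] at hw
    induction hw using Submodule.span_induction with
    | mem v hv =>
      have h1 : ∀ i, v ⬝ᵥ modelVec PS OR q (γhat x) (S.X i x.2) = c v (γhat x) :=
        fun i => hx i v hv _ hxU
      rw [gHat, centreHat, dotProduct_sub, dotProduct_smul, dotProduct_sum]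
      simp only [h1, Finset.sum_const, Finset.card_range, nsmul_eq_mul, smul_eq_mul]
      field_simp
      ring
    | zero => exact zero_dotProduct _
    | add v v' _ _ h1 h2 => rw [add_dotProduct, h1, h2, add_zero]
    | smul a v _ h1 => rw [smul_dotProduct, h1, smul_zero]
  rw [hHat, dotProduct_smul, hg, smul_zero]

/-! #### Second moments -/

/-- Second moments of the moment functions at the limit. -/
noncomputable def secondMoment (S : Sample Ω p Q) (P : Measure Ω) (q : Fin Q) (j : Fin J)
    (u : Params PS OR × Vec J K) (l l' : Fin J ⊕ Fin K) : ℝ :=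
  ∫ ω, S.ind q 0 ω * (score q j u (S.X 0 ω) l * score q j u (S.X 0 ω) l') ∂P

theorem LocallyRegular.tendsto_secondMoment (hR : LocallyRegular PS OR q S P j γ U H B L)
    (hS : S.Identified P q) (hα : (PS j).IsTrueValue S P (γ.1 j))
    (hγ : Tendsto γhat (inProb P) (𝓝 γ)) (l l' : Fin J ⊕ Fin K) :
    Tendsto (fun x : ℕ × Ω => (∑ i ∈ S.arm q x.1 x.2, hHat PS OR q S j (γhat x) x.1 x.2 i l *
      hHat PS OR q S j (γhat x) x.1 x.2 i l') / x.1) (inProb P)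
      (𝓝 (secondMoment S P q j (γ, centre PS OR q S P γ) l l')) := by
  set c := centre PS OR q S P γ with hc
  have hU : U ×ˢ Metric.ball c 1 ∈ 𝓝 (γ, c) :=
    prod_mem_nhds hR.mem_nhds (Metric.ball_mem_nhds _ one_pos)
  have hscore : ∀ᵐ z ∂(S.obsLaw P), z.2.1 = q → ∀ l,
      ContinuousOn (fun u : Params PS OR × Vec J K => score q j u z.1 l)
        (U ×ˢ Metric.ball c 1) := by
    filter_upwards [hR.treated_bounds] with z hz hq l
    have h0 : ∀ u ∈ U ×ˢ Metric.ball c 1, (PS j).prob z.1 q (u.1.1 j) ≠ 0 := fun u hu =>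
      (hz hq u.1 hu.1).1.ne'
    have hp : ContinuousOn (fun u : Params PS OR × Vec J K => (PS j).prob z.1 q (u.1.1 j))
        (U ×ˢ Metric.ball c 1) := ((continuous_prob j z.1).comp continuous_fst).continuousOn
    have hf : Continuous (fun u : Params PS OR × Vec J K => modelVec PS OR q u.1 z.1 l) :=
      (continuous_apply l).comp ((continuous_modelVec z.1).comp continuous_fst)
    have ht : Continuous (fun u : Params PS OR × Vec J K => u.2 l) :=
      (continuous_apply l).comp continuous_snd
    simp only [score_apply]
    exact (hf.continuousOn.div hp h0).sub (ht.continuousOn.mul (continuousOn_const.div hp h0))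
  have h := hS.tendsto_arm_mean
    (φ := fun (u : Params PS OR × Vec J K) z => score q j u z.1 l * score q j u z.1 l')
    (fun u => ((measurable_score j u l).mul (measurable_score j u l')).comp measurable_fst)
    hU (hR.memLp.integrable_sq.const_mul ((2 + ‖c‖) ^ 2)) (hR.score_mul_bound c l l')
    (by filter_upwards [hscore] with z hz hq using (hz hq l).mul (hz hq l'))
    (hγ.prodMk_nhds (hR.tendsto_centreHat hS hα hγ))
  simp only [hHat_eq_score]
  unfold secondMoment
  exact h

/-- The second moment form is positive in the nondegenerate directions: if it vanishes at `v`, then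
`vᵀ f(X; γ)` is constant on `D = q`, hence almost surely by positivity, so `v` is degenerate. -/
theorem LocallyRegular.secondMoment_pos (hR : LocallyRegular PS OR q S P j γ U H B L)
    (hS : S.Identified P q) {v : Vec J K}
    (hv : v ∈ dotOrthogonal (degenerate q γ (S.obsLaw P))) (hv0 : v ≠ 0) :
    0 < ∑ l, ∑ l', v l * v l' * secondMoment S P q j (γ, centre PS OR q S P γ) l l' := by
  set c := centre PS OR q S P γ with hc
  have hγU : γ ∈ U := mem_of_mem_nhds hR.mem_nhds
  have hint : ∀ l l', Integrable (fun ω => S.ind q 0 ω *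
      (score q j (γ, c) (S.X 0 ω) l * score q j (γ, c) (S.X 0 ω) l')) P := fun l l' =>
    ind_mul_dominated hS (φ := fun z => score q j (γ, c) z.1 l * score q j (γ, c) z.1 l')
      (hR.memLp.integrable_sq.const_mul ((2 + ‖c‖) ^ 2))
      (((measurable_score j _ l).mul (measurable_score j _ l')).comp measurable_fst)
      (by
        filter_upwards [hR.score_mul_bound c l l'] with z hz hq
        exact hz hq _ ⟨hγU, Metric.mem_ball_self one_pos⟩)
  have hform : ∀ ω, ∑ l, ∑ l', v l * v l' * (S.ind q 0 ω *
      (score q j (γ, c) (S.X 0 ω) l * score q j (γ, c) (S.X 0 ω) l')) =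
      S.ind q 0 ω * (v ⬝ᵥ score q j (γ, c) (S.X 0 ω)) ^ 2 := by
    intro ω
    rw [sq, dotProduct, Finset.sum_mul_sum, Finset.mul_sum]
    refine Finset.sum_congr rfl fun l _ => ?_
    rw [Finset.mul_sum]
    exact Finset.sum_congr rfl fun l' _ => by ring
  have hint' : Integrable (fun ω => S.ind q 0 ω * (v ⬝ᵥ score q j (γ, c) (S.X 0 ω)) ^ 2) P := by
    refine Integrable.congr ?_ (ae_of_all _ hform)
    exact integrable_finsetSum _ fun l _ => integrable_finsetSum _ fun l' _ =>
      (hint l l').const_mul _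
  have heq : ∑ l, ∑ l', v l * v l' * secondMoment S P q j (γ, c) l l' =
      ∫ ω, S.ind q 0 ω * (v ⬝ᵥ score q j (γ, c) (S.X 0 ω)) ^ 2 ∂P := by
    rw [← integral_congr_ae (ae_of_all _ hform), integral_finsetSum _ fun l _ =>
      integrable_finsetSum _ fun l' _ => (hint l l').const_mul _]
    refine Finset.sum_congr rfl fun l _ => ?_
    rw [integral_finsetSum _ fun l' _ => (hint l l').const_mul _]
    exact Finset.sum_congr rfl fun l' _ => (integral_const_mul _ _).symm
  have hnn : 0 ≤ᵐ[P] fun ω => S.ind q 0 ω * (v ⬝ᵥ score q j (γ, c) (S.X 0 ω)) ^ 2 :=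
    ae_of_all _ fun ω => by
      refine mul_nonneg ?_ (sq_nonneg _)
      unfold Sample.ind
      split_ifs <;> norm_num
  rw [heq]
  refine lt_of_le_of_ne (integral_nonneg_of_ae hnn) fun h0 => hv0 ?_
  have h1 := (integral_eq_zero_iff_of_nonneg_ae hnn hint').1 h0.symm
  have hm : Measurable fun x => v ⬝ᵥ (modelVec PS OR q γ x - c) :=
    Finset.measurable_fun_sum _ fun l _ =>
      measurable_const.mul ((measurable_modelVec γ l).sub measurable_const)
  have h2 : ∀ᵐ ω ∂P, S.D 0 ω = q → v ⬝ᵥ (modelVec PS OR q γ (S.X 0 ω) - c) = 0 := by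
    filter_upwards [h1, hS.ae_of_ae_obsLaw hR.treated_bounds] with ω h3 h4 hq
    have hπ : (PS j).prob (S.X 0 ω) q (γ.1 j) ≠ 0 := (h4 hq γ hγU).1.ne'
    have h5 : S.ind q 0 ω * (v ⬝ᵥ score q j (γ, c) (S.X 0 ω)) ^ 2 = 0 := h3
    rw [show S.ind q 0 ω = 1 from if_pos hq, one_mul, sq_eq_zero_iff, score,
      dotProduct_smul, smul_eq_mul] at h5
    exact (mul_eq_zero.1 h5).resolve_left (one_div_ne_zero hπ)
  have h6 := hS.ae_of_ae_treated hm h2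
  have hm' : Measurable fun z : EuclideanSpace ℝ (Fin p) × Fin Q × ℝ =>
      v ⬝ᵥ modelVec PS OR q γ z.1 :=
    Finset.measurable_fun_sum _ fun l _ =>
      measurable_const.mul ((measurable_modelVec γ l).comp measurable_fst)
  have hdeg : v ∈ degenerate q γ (S.obsLaw P) := by
    refine ⟨v ⬝ᵥ c, ?_⟩
    refine (ae_map_iff (hS.measurable_obs 0).aemeasurable
      (hm' (measurableSet_singleton (v ⬝ᵥ c)))).2 ?_
    filter_upwards [h6] with ω h7
    rw [dotProduct_sub, sub_eq_zero] at h7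
    exact h7
  exact dotProduct_self_eq_zero.1 (hv v hdeg)

/-! #### Existence and size of the multiplier -/

/-- With probability tending to one the empirical likelihood problem has a multiplier, and every
multiplier is uniformly negligible on the sample.  `exists_isRoot` is applied with the radius
`r = 12 A / κ + n^{-1/2}`, where `A` is the size of the mean of the moment functions; the second
summand makes it positive.  As `A = O_p(n^{-1/2})`, its product with the envelope `o_p(n^{1/2})` of
the moment functions tends to zero. -/
theorem LocallyRegular.exists_multiplier (hR : LocallyRegular PS OR q S P j γ U H B L)
    (hS : S.Identified P q) (hα : (PS j).IsTrueValue S P (γ.1 j))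
    {γhat : ℕ → Ω → Params PS OR} (hγ : Tendsto (fun x => γhat x.1 x.2) (inProb P) (𝓝 γ))
    (hroot : RootNConsistent P γhat γ) :
    ∃ e : ℕ × Ω → ℝ, (∀ x, 0 ≤ e x) ∧ Tendsto e (inProb P) (𝓝 0) ∧ ∀ᶠ x in inProb P,
      (∃ l, IsELMultiplier (S.arm q x.1 x.2) (hHat PS OR q S j (γhat x.1 x.2) x.1 x.2) l) ∧
      ∀ l, IsELMultiplier (S.arm q x.1 x.2) (hHat PS OR q S j (γhat x.1 x.2) x.1 x.2) l →
        ∀ i ∈ S.arm q x.1 x.2, |l ⬝ᵥ hHat PS OR q S j (γhat x.1 x.2) x.1 x.2 i| ≤ e x := by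
  set c := centre PS OR q S P γ with hc
  set V := dotOrthogonal (degenerate q γ (S.obsLaw P)) with hV
  set hh : ℕ × Ω → ℕ → Vec J K := fun x => hHat PS OR q S j (γhat x.1 x.2) x.1 x.2 with hhh
  set Mx := runningMax H S.obs with hMx
  have hMx0 : ∀ x, 0 ≤ Mx x := runningMax_nonneg H S.obs
  obtain ⟨κ, hκ, hκV⟩ := exists_quadratic_lower_bound V
    (secondMoment S P q j (γ, c)) fun v hv hv0 => hR.secondMoment_pos hS hv hv0
  -- size of the mean of the moment functions
  set A : ℕ × Ω → ℝ := fun x => ∑ l, |(∑ i ∈ S.arm q x.1 x.2, hh x i l) / x.1| with hA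
  have hA0 : ∀ x, 0 ≤ A x := fun x => Finset.sum_nonneg fun l _ => abs_nonneg _
  have hAM : Tendsto (fun x => A x * Mx x) (inProb P) (𝓝 0) := by
    have h1 := tendsto_finsetSum Finset.univ fun l _ =>
      hR.tendsto_score_mean_mul hS hα hγ hroot l
    simp only [Finset.sum_const_zero] at h1
    refine h1.congr fun x => ?_
    rw [hA, Finset.sum_mul]
  set d : ℝ := ((Fintype.card (Fin J ⊕ Fin K) : ℕ) : ℝ) with hd
  set R : ℕ × Ω → ℝ := fun x => d * (Mx x * (2 + ‖c‖)) with hRdef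
  set r : ℕ × Ω → ℝ := fun x => 12 / κ * A x + 1 / Real.sqrt x.1 with hr
  have hRr : Tendsto (fun x => R x * r x) (inProb P) (𝓝 0) := by
    have h1 := (((hAM.const_mul (12 / κ)).add
      (hS.isIID_obs.tendsto_runningMax_div_sqrt hR.memLp)).const_mul (d * (2 + ‖c‖)))
    simp only [mul_zero, add_zero] at h1
    refine h1.congr fun x => ?_
    simp only [hRdef, hr, hMx]
    ring
  -- convergence of the second moment form
  have hS2 : Tendsto (fun x : ℕ × Ω => ∑ l, ∑ l', |(∑ i ∈ S.arm q x.1 x.2, hh x i l * hh x i l') /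
      x.1 - secondMoment S P q j (γ, c) l l'|) (inProb P) (𝓝 0) := by
    have h1 := tendsto_finsetSum Finset.univ fun l _ => tendsto_finsetSum Finset.univ fun l' _ =>
      ((hR.tendsto_secondMoment hS hα hγ l l').sub_const
        (secondMoment S P q j (γ, c) l l')).abs
    simp only [← hc, sub_self, abs_zero, Finset.sum_const_zero] at h1
    exact h1
  have hinv := hR.tendsto_inv_prob_mean hS hα hγ
  have hcentre := hR.tendsto_centreHat hS hα hγ
  have hR0 : ∀ x, 0 ≤ R x := fun x => mul_nonneg (Nat.cast_nonneg _)
    (mul_nonneg (hMx0 x) (by positivity))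
  have hr0 : ∀ x, 0 ≤ r x := fun x =>
    add_nonneg (mul_nonneg (by positivity) (hA0 x)) (by positivity)
  refine ⟨fun x => R x * r x, fun x => mul_nonneg (hR0 x) (hr0 x), hRr, ?_⟩
  filter_upwards [hγ.eventually_mem hR.mem_nhds, hR.hHat_mem hS hγ,
    eventually_inProb_of_ae (hS.isIID_obs.ae_forall hR.score_bound),
    hRr.eventually_le_const (by norm_num : (0 : ℝ) < 1 / 4),
    hS2.eventually_le_const (half_pos hκ), hinv.eventually_ne one_ne_zero,
    Metric.tendsto_nhds.1 hcentre 1 one_pos,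
    eventually_inProb_of_atTop (eventually_gt_atTop 0)] with x hxU hxV hsc hrR hq2 hne hcx hn
  have hn' : (0 : ℝ) < x.1 := by exact_mod_cast hn
  have harm : (S.arm q x.1 x.2).Nonempty := by
    rw [Finset.nonempty_iff_ne_empty]
    intro h0
    simp [h0] at hne
  have hrpos : 0 < r x := by
    have h1 : 0 < 1 / Real.sqrt x.1 := one_div_pos.2 (Real.sqrt_pos.2 hn')
    have h2 : 0 ≤ 12 / κ * A x := mul_nonneg (by positivity) (hA0 x)
    exact add_pos_of_nonneg_of_pos h2 h1
  have hbound : ∀ i ∈ S.arm q x.1 x.2, ∀ v, |v ⬝ᵥ hh x i| ≤ R x * ‖v‖ := by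
    intro i hi v
    refine abs_dotProduct_le fun l => ?_
    obtain ⟨hi1, hi2⟩ := mem_arm.1 hi
    have h1 := hsc i hi2 _ hxU (centreHat PS OR q S (γhat x.1 x.2) x.1 x.2) l
    have h2 : ‖centreHat PS OR q S (γhat x.1 x.2) x.1 x.2‖ ≤ 1 + ‖c‖ := by
      rw [dist_eq_norm] at hcx
      linarith [norm_sub_norm_le (centreHat PS OR q S (γhat x.1 x.2) x.1 x.2) c]
    have h3 : H (S.obs i x.2) ≤ Mx x := (le_abs_self _).trans (abs_le_runningMax H S.obs hi1)
    refine h1.trans (mul_le_mul h3 (by linarith) (by positivity) (hMx0 x))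
  have hquad : ∀ v ∈ V, (x.1 * (κ / 2)) * ‖v‖ ^ 2 ≤
      ∑ i ∈ S.arm q x.1 x.2, (v ⬝ᵥ hh x i) ^ 2 := by
    intro v hv
    have h1 := hκV v hv
    have h2 := abs_quadratic_sub_le (A := fun l l' =>
      (∑ i ∈ S.arm q x.1 x.2, hh x i l * hh x i l') / x.1)
      (A' := secondMoment S P q j (γ, c)) v
    have h3 := (abs_le.1 (h2.trans (mul_le_mul_of_nonneg_right hq2 (sq_nonneg ‖v‖)))).1
    have h4 : ∑ l, ∑ l', v l * v l' * ((∑ i ∈ S.arm q x.1 x.2, hh x i l * hh x i l') / x.1) =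
        (∑ i ∈ S.arm q x.1 x.2, (v ⬝ᵥ hh x i) ^ 2) / x.1 := by
      rw [sum_sq_dotProduct]
      simp only [Finset.sum_div, mul_div_assoc]
    rw [h4] at h3
    have h5 : κ / 2 * ‖v‖ ^ 2 ≤ (∑ i ∈ S.arm q x.1 x.2, (v ⬝ᵥ hh x i) ^ 2) / x.1 := by linarith
    rw [le_div_iff₀ hn'] at h5
    linarith
  have hlin : ∀ v ∈ V, ∑ i ∈ S.arm q x.1 x.2, v ⬝ᵥ hh x i ≤ (x.1 * A x) * ‖v‖ := by
    intro v _
    have h1 : ∑ i ∈ S.arm q x.1 x.2, v ⬝ᵥ hh x i =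
        x.1 * ∑ l, v l * ((∑ i ∈ S.arm q x.1 x.2, hh x i l) / x.1) := by
      rw [← dotProduct_sum, dotProduct, Finset.mul_sum]
      refine Finset.sum_congr rfl fun l _ => ?_
      rw [Finset.sum_apply]
      field_simp
    rw [h1, mul_assoc]
    refine mul_le_mul_of_nonneg_left ?_ hn'.le
    rw [hA, Finset.sum_mul]
    refine Finset.sum_le_sum fun l _ => (le_abs_self _).trans ?_
    rw [abs_mul, mul_comm]
    exact mul_le_mul_of_nonneg_left (norm_le_pi_norm v l) (abs_nonneg _)
  have hAr : x.1 * A x < x.1 * (κ / 2) * r x / 6 := by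
    have h1 : x.1 * (κ / 2) * r x / 6 = x.1 * (A x + κ / 12 * (1 / Real.sqrt x.1)) := by
      simp only [hr]
      field_simp
      ring
    rw [h1]
    refine mul_lt_mul_of_pos_left ?_ hn'
    have : 0 < κ / 12 * (1 / Real.sqrt x.1) :=
      mul_pos (by positivity) (one_div_pos.2 (Real.sqrt_pos.2 hn'))
    linarith
  obtain ⟨l₀, hl₀r, hl₀⟩ := exists_isRoot hrpos hxV hquad hlin hbound (hR0 x) hAr hrR
  have hsmall : ∀ i ∈ S.arm q x.1 x.2, |l₀ ⬝ᵥ hh x i| ≤ R x * r x := fun i hi =>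
    (hbound i hi l₀).trans (mul_le_mul_of_nonneg_left hl₀r (hR0 x))
  have hpos : ∀ i ∈ S.arm q x.1 x.2, 0 < 1 + l₀ ⬝ᵥ hh x i := fun i hi => by
    linarith [(abs_le.1 (hsmall i hi)).1]
  refine ⟨⟨l₀, hl₀.isELMultiplier harm hpos⟩, fun l hl i hi => ?_⟩
  have h1 := hl.1.dotProduct_eq hl₀ (fun i hi => hl.pos hi) hpos hi
  rw [h1]
  exact hsmall i hi

/-- Consistency at a correct propensity score model: the multipliers being negligible, the estimator
is asymptotically the normalised inverse probability weighting estimator. -/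
theorem LocallyRegular.tendsto_muMR (hR : LocallyRegular PS OR q S P j γ U H B L)
    (hS : S.Identified P q) (hα : (PS j).IsTrueValue S P (γ.1 j))
    {γhat : ℕ → Ω → Params PS OR} (hγ : Tendsto (fun x => γhat x.1 x.2) (inProb P) (𝓝 γ))
    (hroot : RootNConsistent P γhat γ) {lam : ℕ → Ω → Vec J K}
    (hlam : ∀ n ω,
      (∃ l, IsELMultiplier (S.arm q n ω) (hHat PS OR q S j (γhat n ω) n ω) l) →
        IsELMultiplier (S.arm q n ω) (hHat PS OR q S j (γhat n ω) n ω) (lam n ω)) :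
    (∀ᶠ x in inProb P,
      IsELMultiplier (S.arm q x.1 x.2) (hHat PS OR q S j (γhat x.1 x.2) x.1 x.2) (lam x.1 x.2) ∧
      IsRoot (S.arm q x.1 x.2) (gHat PS OR q S (γhat x.1 x.2) x.1 x.2)
        (rhoPi PS OR q S j (γhat x.1 x.2) (lam x.1 x.2) x.1 x.2)) ∧
    Tendsto (fun x => muMR PS OR q S (γhat x.1 x.2)
      (rhoPi PS OR q S j (γhat x.1 x.2) (lam x.1 x.2) x.1 x.2) x.1 x.2) (inProb P)
      (𝓝 (S.apo P q)) := by
  have hprob : IsProbabilityMeasure (S.obsLaw P) :=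
    Measure.isProbabilityMeasure_map (hS.measurable_obs 0).aemeasurable
  obtain ⟨e, he0, he, hmult⟩ := hR.exists_multiplier hS hα hγ hroot
  have hθ : ∀ᶠ x in inProb P, centreHat PS OR q S (γhat x.1 x.2) x.1 x.2 (Sum.inl j) ≠ 0 :=
    ((tendsto_pi_nhds.1 (hR.tendsto_centreHat hS hα hγ)) (Sum.inl j)).eventually_ne
      (centre_inl_pos hS hα).ne'
  have hbd : ∀ᶠ x in inProb P, ∀ i ∈ S.arm q x.1 x.2,
      (PS j).prob (S.X i x.2) q ((γhat x.1 x.2).1 j) ≠ 0 ∧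
      |1 / (PS j).prob (S.X i x.2) q ((γhat x.1 x.2).1 j)| ≤ |H (S.obs i x.2)| ∧
      |S.Y i x.2 / (PS j).prob (S.X i x.2) q ((γhat x.1 x.2).1 j)| ≤ |B (S.obs i x.2)| := by
    filter_upwards [hγ.eventually_mem hR.mem_nhds,
      eventually_inProb_of_ae (hS.isIID_obs.ae_forall hR.treated_bounds)] with x hxU hx i hi
    obtain ⟨h1, -, h2, -, h3⟩ := hx i (mem_arm.1 hi).2 _ hxU
    exact ⟨h1.ne', h2.trans (le_abs_self _), h3.trans (le_abs_self _)⟩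
  refine ⟨?_, ?_⟩
  · filter_upwards [hmult, hθ, hbd] with x hx hθx hbx
    have h1 := hlam x.1 x.2 hx.1
    exact ⟨h1, h1.1.rhoPi hθx fun i hi => (hbx i hi).1⟩
  -- replacing the denominators `1 + lamᵀ h` by one does not change the limits of the means
  have hpert : ∀ {φ : ℕ × Ω → ℕ → ℝ} {C : EuclideanSpace ℝ (Fin p) × Fin Q × ℝ → ℝ} {a : ℝ},
      Integrable C (S.obsLaw P) →
      (∀ᶠ x in inProb P, ∀ i ∈ S.arm q x.1 x.2, |φ x i| ≤ |C (S.obs i x.2)|) →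
      Tendsto (fun x => (∑ i ∈ S.arm q x.1 x.2, φ x i) / x.1) (inProb P) (𝓝 a) →
      Tendsto (fun x => (∑ i ∈ S.arm q x.1 x.2, φ x i /
        (1 + lam x.1 x.2 ⬝ᵥ hHat PS OR q S j (γhat x.1 x.2) x.1 x.2 i)) / x.1)
        (inProb P) (𝓝 a) := by
    intro φ C a hC hφ hlim
    have hCm := hS.isIID_obs.law_large_numbers hC.abs
    have h0 := (he.const_mul 2).mul hCm
    rw [mul_zero, zero_mul] at h0
    have hdiff : Tendsto (fun x => (∑ i ∈ S.arm q x.1 x.2, φ x i /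
        (1 + lam x.1 x.2 ⬝ᵥ hHat PS OR q S j (γhat x.1 x.2) x.1 x.2 i)) / x.1 -
        (∑ i ∈ S.arm q x.1 x.2, φ x i) / x.1) (inProb P) (𝓝 0) := by
      refine squeeze_zero_norm' ?_ h0
      filter_upwards [hmult, hφ, he.eventually_le_const (by norm_num : (0 : ℝ) < 1 / 2)]
        with x hx hφx hex
      have hsm := hx.2 _ (hlam x.1 x.2 hx.1)
      rw [← sub_div, Real.norm_eq_abs, abs_div, Nat.abs_cast, ← mul_div_assoc]
      refine div_le_div_of_nonneg_right ?_ (Nat.cast_nonneg _)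
      refine (abs_sum_div_one_add_sub_le hex hφx hsm).trans ?_
      refine mul_le_mul_of_nonneg_left ?_ (mul_nonneg zero_le_two (he0 x))
      exact Finset.sum_le_sum_of_subset_of_nonneg (Finset.filter_subset _ _)
        fun i _ _ => abs_nonneg _
    have := hdiff.add hlim
    rw [zero_add] at this
    exact this.congr fun x => by ring
  have hnum := hpert hR.integrable_outcome (hbd.mono fun x hx i hi => (hx i hi).2.2)
    (hR.tendsto_ipw_outcome_mean hS hα hγ)
  have hden := hpert (hR.memLp.integrable (by norm_num)) (hbd.mono fun x hx i hi => (hx i hi).2.1)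
    (hR.tendsto_inv_prob_mean hS hα hγ)
  have hlim := hnum.div hden one_ne_zero
  rw [div_one] at hlim
  refine hlim.congr' ?_
  filter_upwards [hθ, hbd, eventually_inProb_of_atTop (eventually_gt_atTop 0)] with x hθx hbx hn
  have hn' : (x.1 : ℝ) ≠ 0 := by exact_mod_cast hn.ne'
  rw [muMR_rhoPi hθx fun i hi => (hbx i hi).1]
  simp only [Pi.div_apply]
  rw [div_div_div_cancel_right₀ hn']

end Multiplier

end MultiplyRobust

open MultiplyRobust in
theorem theorem3 {Ω : Type*} [MeasurableSpace Ω] [StandardBorelSpace Ω] (P : Measure Ω)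
    [IsProbabilityMeasure P] {p Q J K : ℕ} (S : Sample Ω p Q) (q : Fin Q)
    (hS : S.Identified P q)
    (PS : Fin J → PSModel p Q) (OR : Fin K → ORModel p Q)
    (γhat : ℕ → Ω → Params PS OR) (γ : Params PS OR)
    (hγ : TendstoInMeasure P γhat atTop (fun _ => γ))
    (hPS : ∀ j, (PS j).CorrectlySpecified S P → (PS j).IsTrueValue S P (γ.1 j))
    (hOR : ∀ k, (OR k).CorrectlySpecified S P → (OR k).IsTrueValue S P (γ.2 k)) :
    (∀ j, (PS j).CorrectlySpecified S P → RegularPS PS OR q S P j γhat γ →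
      ∀ lam : ℕ → Ω → Vec J K,
        (∀ n ω, (∃ l, IsELMultiplier (S.arm q n ω) (hHat PS OR q S j (γhat n ω) n ω) l) →
          IsELMultiplier (S.arm q n ω) (hHat PS OR q S j (γhat n ω) n ω) (lam n ω)) →
        Tendsto (fun n => P {ω |
          ¬ (IsELMultiplier (S.arm q n ω) (hHat PS OR q S j (γhat n ω) n ω) (lam n ω) ∧
            IsRoot (S.arm q n ω) (gHat PS OR q S (γhat n ω) n ω)
              (rhoPi PS OR q S j (γhat n ω) (lam n ω) n ω))}) atTop (𝓝 0) ∧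
        TendstoInMeasure P (fun n ω => muMR PS OR q S (γhat n ω)
          (rhoPi PS OR q S j (γhat n ω) (lam n ω) n ω) n ω) atTop (fun _ => S.apo P q)) ∧
    (∀ k, (OR k).CorrectlySpecified S P →
      ∀ (rho : ℕ → Ω → Vec J K) (ρ : Vec J K),
        Tendsto (fun n => P {ω |
          ¬ IsRoot (S.arm q n ω) (gHat PS OR q S (γhat n ω) n ω) (rho n ω)}) atTop (𝓝 0) →
        TendstoInMeasure P rho atTop (fun _ => ρ) →
        RegularOR PS OR q S P k γ ρ →
        TendstoInMeasure P (fun n ω => muMR PS OR q S (γhat n ω) (rho n ω) n ω) atTop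
          (fun _ => S.apo P q)) := by
  have hγ' := tendstoInMeasure_iff_inProb.1 hγ
  refine ⟨fun j hj hreg lam hlam => ?_, fun k hk rho ρ hroot hrho hreg => ?_⟩
  · obtain ⟨U, hU, H, B, L, hH, hB, hL, htr, hlip, hconst⟩ := hreg.locally_regular
    have hR : LocallyRegular PS OR q S P j γ U H B L := ⟨hU, hH, hB, hL, htr, hlip, hconst⟩
    have h := hR.tendsto_muMR hS (hPS j hj) hγ' hreg.rootN hlam
    exact ⟨eventually_inProb.1 h.1, tendstoInMeasure_iff_inProb.2 h.2⟩
  · exact tendstoInMeasure_iff_inProb.2 (tendsto_muMR_of_outcomeReg hS hγ' (hOR k hk)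
      (rho := fun x => rho x.1 x.2) (eventually_inProb.2 hroot)
      (tendstoInMeasure_iff_inProb.1 hrho) hreg)
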